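/- Let $\mathcal H$ be a real Hilbert space, $\mathcal L(\mathcal H)$ the Banach space of bounded linear operators on $\mathcal H$ with the operator norm, and $\mathcal H^{\otimes 2}$ the Hilbert space tensor square (the completion of the algebraic tensor product $\mathcal H\otimes\mathcal H$ for $\langle a\otimes b, c\otimes d\rangle=\langle a,c\rangle\langle b,d\rangle$). For $x\in\mathcal H$ put $x^{\otimes2}=x\otimes x$, and for $T\in\mathcal L(\mathcal H)$ let $T^{\otimes2}$ be the bounded operator on $\mathcal H^{\otimes2}$ with $T^{\otimes2}(a\otimes b)=Ta\otimes Tb$. A random operator is a Bochner (strongly) measurable map from a probability space to $\mathcal L(\mathcal H)$, and $\mathbb E$ of an operator-valued map denotes its Bochner integral. Let $A,A_1,A_2,\dots$ be i.i.d. random operators on a probability space $(\Omega,\mathcal F,\mathbb P)$ such that $\|A\|$ is bounded. Then $A$, $(A-\mathbb EA)^{\otimes2}$ and the integrand below are Bochner integrable, so that $$\Sigma:=\int_0^1\bigl(e^{\mathbb EA\,s}\bigr)^{\otimes2}\;\mathbb E(A-\mathbb EA)^{\otimes2}\;\bigl(e^{\mathbb EA\,(1-s)}\bigr)^{\otimes2}\,ds$$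 is a well-defined bounded operator on $\mathcal H^{\otimes2}$, and the sequence of random operators $$\sqrt n\,\bigl(e^{A_1/n}e^{A_2/n}\cdots e^{A_n/n}-e^{\mathbb EA}\bigr)$$ converges in distribution in the weak operator topology to $N(0,\Sigma)$ as $n\to\infty$. This means: for all $x,y\in\mathcal H$ one has $\langle y^{\otimes2},\Sigma x^{\otimes2}\rangle\ge0$, and $$\Bigl\langle y,\sqrt n\,\bigl(e^{A_1/n}\cdots e^{A_n/n}-e^{\mathbb EA}\bigr)x\Bigr\rangle\xrightarrow[n\to\infty]{d}N\bigl(0,\langle y^{\otimes2},\Sigma x^{\otimes2}\rangle\bigr),$$ where $N(0,\sigma^2)$ is the centred Gaussian law on $\mathbb R$ with variance $\sigma^2$ (the Dirac mass at $0$ if $\sigma^2=0$). -/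

import Mathlib

open MeasureTheory ProbabilityTheory Filter
open scoped TensorProduct InnerProductSpace Topology

noncomputable section

namespace RandomExp

variable {H : Type*} [NormedAddCommGroup H] [InnerProductSpace ℝ H]

variable (H) in
/-- The Hilbert space tensor square of `H`: the completion of the algebraic tensor product
for the inner product with `⟪a ⊗ b, c ⊗ d⟫ = ⟪a, c⟫ * ⟪b, d⟫`. -/
def TensorSq : Type _ := UniformSpace.Completion (H ⊗[ℝ] H)

instance : NormedAddCommGroup (TensorSq H) :=
  inferInstanceAs (NormedAddCommGroup (UniformSpace.Completion (H ⊗[ℝ] H)))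

instance : InnerProductSpace ℝ (TensorSq H) :=
  inferInstanceAs (InnerProductSpace ℝ (UniformSpace.Completion (H ⊗[ℝ] H)))

instance : CompleteSpace (TensorSq H) :=
  inferInstanceAs (CompleteSpace (UniformSpace.Completion (H ⊗[ℝ] H)))

variable (H) in
/-- The canonical isometric embedding of the algebraic tensor product into its completion. -/
def toTensorSq : H ⊗[ℝ] H →ₗᵢ[ℝ] TensorSq H :=
  UniformSpace.Completion.toComplₗᵢ (𝕜 := ℝ) (E := H ⊗[ℝ] H)

theorem denseRange_toTensorSq : DenseRange (toTensorSq H) :=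
  UniformSpace.Completion.denseRange_coe (α := H ⊗[ℝ] H)

/-- The vector `x ⊗ x`. -/
def vecSq (x : H) : TensorSq H := toTensorSq H (x ⊗ₜ[ℝ] x)

/-- The bounded operator `T ⊗ T`: the continuous extension of the operator on the algebraic tensor
product which maps `a ⊗ b` to `T a ⊗ T b`. -/
def opSq (T : H →L[ℝ] H) : TensorSq H →L[ℝ] TensorSq H :=
  ((toTensorSq H).toContinuousLinearMap ∘L TensorProduct.mapL T T).extend
    (toTensorSq H).toContinuousLinearMap

/-- `T ⊗ T` maps `a ⊗ b` to `T a ⊗ T b`; by density this determines it. -/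
theorem opSq_tmul (T : H →L[ℝ] H) (a b : H) :
    opSq T (toTensorSq H (a ⊗ₜ[ℝ] b)) = toTensorSq H (T a ⊗ₜ[ℝ] T b) := by
  have h : IsUniformInducing (toTensorSq H).toContinuousLinearMap :=
    (toTensorSq H).isometry.isUniformInducing
  have h' : DenseRange (toTensorSq H).toContinuousLinearMap := denseRange_toTensorSq
  have key := ContinuousLinearMap.extend_eq
    ((toTensorSq H).toContinuousLinearMap ∘L TensorProduct.mapL T T) h' h (a ⊗ₜ[ℝ] b)
  exact key

variable {Ω : Type*} [MeasurableSpace Ω]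

/-- The random variable `(A - E A) ⊗ (A - E A)`, with values in the bounded operators. -/
def centeredSq (P : Measure Ω) (A : Ω → H →L[ℝ] H) (ω : Ω) : TensorSq H →L[ℝ] TensorSq H :=
  opSq (A ω - ∫ ω', A ω' ∂P)

/-- The integrand `(e^{s E A})^{⊗2} E (A - E A)^{⊗2} (e^{(1 - s) E A})^{⊗2}`. -/
def covIntegrand (P : Measure Ω) (A : Ω → H →L[ℝ] H) (s : ℝ) : TensorSq H →L[ℝ] TensorSq H :=
  opSq (NormedSpace.exp (s • ∫ ω, A ω ∂P)) * (∫ ω, centeredSq P A ω ∂P) *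
    opSq (NormedSpace.exp ((1 - s) • ∫ ω, A ω ∂P))

/-- The limiting covariance operator on the Hilbert space tensor square, as a Bochner integral. -/
def limitCov (P : Measure Ω) (A : Ω → H →L[ℝ] H) : TensorSq H →L[ℝ] TensorSq H :=
  ∫ s in (0 : ℝ)..1, covIntegrand P A s

/-- The product `e^{B 0 / n} ∘ e^{B 1 / n} ∘ ⋯ ∘ e^{B (n - 1) / n}`, in this order. -/
def expProd (B : ℕ → H →L[ℝ] H) (n : ℕ) : H →L[ℝ] H :=
  ((List.range n).map fun k => NormedSpace.exp ((n : ℝ)⁻¹ • B k)).prod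

/-- The sequence `Y` of random operators converges in distribution, in the weak operator topology,
to the Gaussian `N(0, S)`: for all `x`, `y` the real random variables `⟪y, Y n x⟫` converge in
distribution to the centred Gaussian of variance `⟪y ⊗ y, S (x ⊗ x)⟫`, which is nonnegative.
Variance `0` means the Dirac mass at `0`. -/
def TendstoInDistributionWOT (P : Measure Ω) [IsProbabilityMeasure P]
    (Y : ℕ → Ω → H →L[ℝ] H) (S : TensorSq H →L[ℝ] TensorSq H) : Prop :=
  ∀ x y : H, 0 ≤ ⟪vecSq y, S (vecSq x)⟫_ℝ ∧
    TendstoInDistribution (fun n ω => ⟪y, Y n ω x⟫_ℝ) atTop (id : ℝ → ℝ) (fun _ => P)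
      (gaussianReal 0 (⟪vecSq y, S (vecSq x)⟫_ℝ).toNNReal)

end RandomExp

end

/-! Write M = 𝔼A, B_k = e^{X_k/n}, b = 𝔼e^{A/n} and c = e^{M/n}. Replacing the factors of the
product by b one at a time gives B_0⋯B_{n-1} - b^n = Σ_k (B_0⋯B_{k-1})(B_k - b) b^{n-1-k}. Replacing
each random prefix by b^k in turn splits this into a sum linear in the independent increments B_k -
b and a remainder (`sum_prod_sub_pow_mul`).

Tested against x and y, the terms of the remainder are martingale differences, hence orthogonal in
L². The increments are O(1/n), and the prefix defect, seen through its adjoint on the fixed vector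
y, has second moment O(1/n) (`integral_norm_adjointDefect_sq_le`). So the remainder has second
moment n · (1/n) · (1/n²) = O(1/n²) (`integral_sum_inner_adjointDefect_sq_le`), which vanishes after
multiplication by (√n)² = n.

In the linear sum, b - c = O(1/n²) and B_k - b = (X_k - M)/n + O(1/n²), so up to a uniform error
O(1/n) it equals (1/n) Σ_k e^{(k/n)M} (X_k - M) e^{(1-k/n)M}, and b^n may be replaced by c^n = e^M
(`exists_integral_linearization_error_sq_le`).

After scaling by √n there remains a triangular array of centred independent variables of size
O(1/√n), to which `tendstoInDistribution_sum_triangular` applies. Pairing with y ⊗ y and x ⊗ x turns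
the covariance integrand at s into the variance of ⟪y, e^{sM}(A - M)e^{(1-s)M} x⟫
(`inner_vecSq_covIntegrand`). Hence the variances of the sums are Riemann sums of that integrand,
and the limit is nonnegative. -/

noncomputable section

namespace RandomExp

/-! ### Tensor squares of operators and the covariance operator. -/

section Tensor

variable {H : Type*} [NormedAddCommGroup H] [InnerProductSpace ℝ H]

theorem opSq_toTensorSq (T : H →L[ℝ] H) (z : H ⊗[ℝ] H) :
    opSq T (toTensorSq H z) = toTensorSq H (TensorProduct.mapL T T z) :=
  ContinuousLinearMap.extend_eq ((toTensorSq H).toContinuousLinearMap ∘L TensorProduct.mapL T T)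
    denseRange_toTensorSq (toTensorSq H).isometry.isUniformInducing z

theorem opSq_vecSq (T : H →L[ℝ] H) (x : H) : opSq T (vecSq x) = vecSq (T x) :=
  opSq_tmul T x x

theorem inner_vecSq (x y : H) : ⟪vecSq y, vecSq x⟫_ℝ = ⟪y, x⟫_ℝ ^ 2 := by
  rw [vecSq, vecSq, LinearIsometry.inner_map_map, TensorProduct.inner_tmul, sq]

/-- On the algebraic tensor product S ⊗ S - T ⊗ T = (S - T) ⊗ S + T ⊗ (S - T); density carries the
bound to the completion. It yields both continuity of `opSq`, which is quadratic and not linear,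
and, at T = 0, its norm bound. -/
theorem norm_opSq_sub_le (S T : H →L[ℝ] H) :
    ‖opSq S - opSq T‖ ≤ (‖S‖ + ‖T‖) * ‖S - T‖ := by
  refine ContinuousLinearMap.opNorm_le_bound _ (by positivity) fun z => ?_
  refine denseRange_toTensorSq.induction_on (p := fun z =>
    ‖(opSq S - opSq T) z‖ ≤ (‖S‖ + ‖T‖) * ‖S - T‖ * ‖z‖) z
    (isClosed_le (by fun_prop) (by fun_prop)) fun w => ?_
  have hsplit : TensorProduct.mapL S S - TensorProduct.mapL T T =
      TensorProduct.mapL (S - T) S + TensorProduct.mapL T (S - T) := by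
    have h1 := TensorProduct.mapL_add_left (S - T) T S
    have h2 := TensorProduct.mapL_add_right T (S - T) T
    simp only [sub_add_cancel] at h1 h2
    rw [h1, h2]
    abel
  have hnorm : ‖TensorProduct.mapL S S - TensorProduct.mapL T T‖ ≤ (‖S‖ + ‖T‖) * ‖S - T‖ := by
    rw [hsplit]
    have h1 := TensorProduct.norm_mapL_le (S - T) S
    have h2 := TensorProduct.norm_mapL_le T (S - T)
    have h3 := norm_add_le (TensorProduct.mapL (S - T) S) (TensorProduct.mapL T (S - T))
    linarith
  rw [sub_apply, opSq_toTensorSq, opSq_toTensorSq, ← map_sub,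
    LinearIsometry.norm_map, LinearIsometry.norm_map, ← sub_apply]
  exact (ContinuousLinearMap.le_opNorm _ _).trans (by gcongr)

theorem continuous_opSq : Continuous (opSq : (H →L[ℝ] H) → TensorSq H →L[ℝ] TensorSq H) := by
  refine continuous_iff_continuousAt.2 fun T => ?_
  rw [ContinuousAt, tendsto_iff_norm_sub_tendsto_zero]
  refine squeeze_zero (fun _ => norm_nonneg _) (fun S => norm_opSq_sub_le S T) ?_
  have : Continuous fun S : H →L[ℝ] H => (‖S‖ + ‖T‖) * ‖S - T‖ := by fun_prop
  simpa using this.tendsto T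

theorem norm_opSq_le (T : H →L[ℝ] H) : ‖opSq T‖ ≤ ‖T‖ ^ 2 := by
  have h0 : opSq (0 : H →L[ℝ] H) = 0 := by
    ext z
    refine denseRange_toTensorSq.induction_on (p := fun z => opSq (0 : H →L[ℝ] H) z = 0) z
      (isClosed_eq (by fun_prop) (by fun_prop)) fun w => ?_
    simp [opSq_toTensorSq]
  have h := norm_opSq_sub_le T 0
  simp only [h0, sub_zero, norm_zero, add_zero] at h
  rwa [sq]

variable {Ω : Type*} [MeasurableSpace Ω] {P : Measure Ω} {A : Ω → H →L[ℝ] H}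

theorem integrable_of_norm_le [IsFiniteMeasure P] (hA : AEStronglyMeasurable A P)
    (hbdd : ∃ ρ : ℝ, ∀ᵐ ω ∂P, ‖A ω‖ ≤ ρ) : Integrable A P :=
  let ⟨_, h⟩ := hbdd
  Integrable.of_bound hA _ h

theorem integrable_centeredSq [IsFiniteMeasure P] (hA : AEStronglyMeasurable A P)
    (hbdd : ∃ ρ : ℝ, ∀ᵐ ω ∂P, ‖A ω‖ ≤ ρ) : Integrable (centeredSq P A) P := by
  obtain ⟨ρ, hρ⟩ := hbdd
  refine Integrable.of_bound (C := (ρ + ‖∫ ω, A ω ∂P‖) ^ 2) ?_ ?_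
  · exact continuous_opSq.comp_aestronglyMeasurable (hA.sub aestronglyMeasurable_const)
  · filter_upwards [hρ] with ω hω
    refine (norm_opSq_le _).trans ?_
    gcongr
    exact (norm_sub_le _ _).trans (by gcongr)

theorem continuous_exp_smul {𝔸 : Type*} [NormedRing 𝔸] [NormedAlgebra ℝ 𝔸] [CompleteSpace 𝔸]
    {f : ℝ → ℝ} (hf : Continuous f) (a : 𝔸) : Continuous fun s => NormedSpace.exp (f s • a) := by
  let : NormedAlgebra ℚ 𝔸 := NormedAlgebra.restrictScalars ℚ ℝ 𝔸
  exact NormedSpace.exp_continuous.comp (hf.smul continuous_const)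

theorem continuous_covIntegrand [CompleteSpace H] (P : Measure Ω) (A : Ω → H →L[ℝ] H) :
    Continuous (covIntegrand P A) := by
  have h1 : Continuous fun s : ℝ => opSq (NormedSpace.exp (s • ∫ ω, A ω ∂P)) :=
    continuous_opSq.comp (continuous_exp_smul continuous_id (∫ ω, A ω ∂P))
  have h2 : Continuous fun s : ℝ => opSq (NormedSpace.exp ((1 - s) • ∫ ω, A ω ∂P)) :=
    h1.comp (continuous_sub_left 1)
  exact (h1.mul continuous_const).mul h2

/-- The pairing with fixed vectors is a bounded functional, so it passes under the Bochner integral;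
on pure squares ⟪y ⊗ y, z ⊗ z⟫ = ⟪y, z⟫². The square under the integral is the source of
nonnegativity. -/
theorem inner_vecSq_covIntegrand (h : Integrable (centeredSq P A) P) (s : ℝ) (x y : H) :
    ⟪vecSq y, covIntegrand P A s (vecSq x)⟫_ℝ =
      ∫ ω, ⟪y, (NormedSpace.exp (s • ∫ ω, A ω ∂P) * (A ω - ∫ ω, A ω ∂P) *
        NormedSpace.exp ((1 - s) • ∫ ω, A ω ∂P)) x⟫_ℝ ^ 2 ∂P := by
  set M := ∫ ω, A ω ∂P
  set x' := NormedSpace.exp ((1 - s) • M) x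
  let L : (TensorSq H →L[ℝ] TensorSq H) →L[ℝ] ℝ :=
    (innerSL ℝ (vecSq y)) ∘L (opSq (NormedSpace.exp (s • M))) ∘L
      (ContinuousLinearMap.apply ℝ (TensorSq H) (vecSq x'))
  have hL : ⟪vecSq y, covIntegrand P A s (vecSq x)⟫_ℝ = L (∫ ω, centeredSq P A ω ∂P) := by
    simp [covIntegrand, L, x', M, opSq_vecSq]
  rw [hL, ← ContinuousLinearMap.integral_comp_comm L h]
  refine integral_congr_ae (ae_of_all _ fun ω => ?_)
  simp [L, centeredSq, opSq_vecSq, inner_vecSq, x', M]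

theorem inner_vecSq_limitCov [CompleteSpace H] (P : Measure Ω) (A : Ω → H →L[ℝ] H) (x y : H) :
    ⟪vecSq y, limitCov P A (vecSq x)⟫_ℝ =
      ∫ s in (0 : ℝ)..1, ⟪vecSq y, covIntegrand P A s (vecSq x)⟫_ℝ := by
  let L : (TensorSq H →L[ℝ] TensorSq H) →L[ℝ] ℝ :=
    (innerSL ℝ (vecSq y)) ∘L (ContinuousLinearMap.apply ℝ (TensorSq H) (vecSq x))
  exact (L.intervalIntegral_comp_comm
    ((continuous_covIntegrand P A).intervalIntegrable 0 1)).symm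

end Tensor

/-! ### Norm bounds for powers and exponentials in a Banach algebra. -/

section ExpBounds

variable {𝔸 : Type*} [NormedRing 𝔸]

/-- Only ‖1‖ ≤ 1 is assumed, not ‖1‖ = 1: on the zero space the identity operator has norm 0. -/
theorem norm_pow_le_of_norm_one_le (h1 : ‖(1 : 𝔸)‖ ≤ 1) (T : 𝔸) (n : ℕ) : ‖T ^ n‖ ≤ ‖T‖ ^ n := by
  rcases n.eq_zero_or_pos with rfl | hn
  · simpa using h1
  · exact norm_pow_le' T hn

theorem norm_pow_sub_pow_le (h1 : ‖(1 : 𝔸)‖ ≤ 1) {b c : 𝔸} {β : ℝ} (hβ : 1 ≤ β) (hb : ‖b‖ ≤ β)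
    (hc : ‖c‖ ≤ β) (k : ℕ) : ‖b ^ k - c ^ k‖ ≤ k * β ^ k * ‖b - c‖ := by
  have h0 : 0 ≤ β := zero_le_one.trans hβ
  induction k with
  | zero => simp
  | succ k ih =>
    have hsplit : b ^ (k + 1) - c ^ (k + 1) = (b ^ k - c ^ k) * b + c ^ k * (b - c) := by
      rw [pow_succ, pow_succ]
      noncomm_ring
    have hck : ‖c ^ k‖ ≤ β ^ (k + 1) :=
      (norm_pow_le_of_norm_one_le h1 c k).trans
        ((pow_le_pow_left₀ (norm_nonneg _) hc k).trans (pow_le_pow_right₀ hβ k.le_succ))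
    calc ‖b ^ (k + 1) - c ^ (k + 1)‖
        ≤ ‖b ^ k - c ^ k‖ * ‖b‖ + ‖c ^ k‖ * ‖b - c‖ := by
          rw [hsplit]
          exact (norm_add_le _ _).trans (add_le_add (norm_mul_le _ _) (norm_mul_le _ _))
      _ ≤ (k * β ^ k * ‖b - c‖) * β + β ^ (k + 1) * ‖b - c‖ := by gcongr
      _ = ((k + 1 : ℕ) : ℝ) * β ^ (k + 1) * ‖b - c‖ := by push_cast; ring

theorem norm_mul_mul_le {a b c : 𝔸} {α β γ : ℝ} (ha : ‖a‖ ≤ α) (hb : ‖b‖ ≤ β) (hc : ‖c‖ ≤ γ) :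
    ‖a * b * c‖ ≤ α * β * γ := by
  have h0 : 0 ≤ α := (norm_nonneg _).trans ha
  have h1 : 0 ≤ β := (norm_nonneg _).trans hb
  calc ‖a * b * c‖ ≤ ‖a‖ * ‖b‖ * ‖c‖ :=
        (norm_mul_le _ _).trans (by gcongr; exact norm_mul_le _ _)
    _ ≤ α * β * γ := by gcongr

variable [NormedAlgebra ℝ 𝔸]

/-- If `b` is close to `e^{h M}` and `Z` is close to `h D`, then `b ^ k * Z * b ^ m` is close to
`h c ^ k * D * c ^ (m + 1)` with `c = e^{h M}`. -/
theorem norm_pow_mul_mul_pow_sub_le (h1 : ‖(1 : 𝔸)‖ ≤ 1) {b c Z D : 𝔸} {n : ℕ} {E K L : ℝ}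
    (hE : 1 ≤ E) {β : ℝ} (hβ : 1 ≤ β) (hβn : β ^ n ≤ E) (hb : ‖b‖ ≤ β) (hc : ‖c‖ ≤ β)
    (hbc : ‖b - c‖ ≤ K * ((n : ℝ)⁻¹) ^ 2) (hZD : ‖Z - (n : ℝ)⁻¹ • D‖ ≤ K * ((n : ℝ)⁻¹) ^ 2)
    (hZ : ‖Z‖ ≤ L * (n : ℝ)⁻¹) (hD : ‖D‖ ≤ L) (hc1 : ‖1 - c‖ ≤ L * (n : ℝ)⁻¹)
    {k m : ℕ} (hkm : k + m + 1 = n) :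
    ‖b ^ k * Z * b ^ m - (n : ℝ)⁻¹ • (c ^ k * D * c ^ (m + 1))‖ ≤
      (2 * E ^ 2 * K * L + E ^ 2 * K + E ^ 2 * L ^ 2) * ((n : ℝ)⁻¹) ^ 2 := by
  have hβ0 : 0 ≤ β := zero_le_one.trans hβ
  have hn : (0 : ℝ) < n := by exact_mod_cast (by omega : 0 < n)
  set h := (n : ℝ)⁻¹ with hh
  have hpos : 0 < h := inv_pos.2 hn
  have hK : 0 ≤ K := nonneg_of_mul_nonneg_left ((norm_nonneg _).trans hbc) (by positivity)
  have hL : 0 ≤ L := (norm_nonneg _).trans hD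
  have hpow : ∀ j ≤ n, β ^ j ≤ E := fun j hj => (pow_le_pow_right₀ hβ hj).trans hβn
  have hbp : ∀ j ≤ n, ‖b ^ j‖ ≤ E := fun j hj =>
    (norm_pow_le_of_norm_one_le h1 b j).trans
      ((pow_le_pow_left₀ (norm_nonneg _) hb j).trans (hpow j hj))
  have hcp : ∀ j ≤ n, ‖c ^ j‖ ≤ E := fun j hj =>
    (norm_pow_le_of_norm_one_le h1 c j).trans
      ((pow_le_pow_left₀ (norm_nonneg _) hc j).trans (hpow j hj))
  have hsub : ∀ j ≤ n, ‖b ^ j - c ^ j‖ ≤ E * K * h := fun j hj => by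
    have hj' : (j : ℝ) ≤ n := by exact_mod_cast hj
    calc ‖b ^ j - c ^ j‖ ≤ j * β ^ j * ‖b - c‖ := norm_pow_sub_pow_le h1 hβ hb hc j
      _ ≤ n * E * (K * h ^ 2) := by gcongr; exact hpow j hj
      _ = E * K * h * (n * h) := by ring
      _ = E * K * h := by rw [hh, mul_inv_cancel₀ hn.ne', mul_one]
  have hhD : ‖h • D‖ ≤ h * L := by
    rw [norm_smul, Real.norm_of_nonneg hpos.le]
    gcongr
  -- One factor is exchanged at a time. The last term pays for the additional factor c on the right,
  -- which makes the exponents k and m + 1 add up to n, so that the powers of c become e^{sM} and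
  -- e^{(1-s)M} with s = k/n.
  have hsplit : b ^ k * Z * b ^ m - h • (c ^ k * D * c ^ (m + 1)) =
      (b ^ k - c ^ k) * Z * b ^ m + c ^ k * (Z - h • D) * b ^ m
        + c ^ k * (h • D) * (b ^ m - c ^ m) + c ^ k * (h • D) * (c ^ m * (1 - c)) := by
    have : h • (c ^ k * D * c ^ (m + 1)) = c ^ k * (h • D) * c ^ (m + 1) := by simp
    rw [this, pow_succ]
    noncomm_ring
  have hcm : ‖c ^ m * (1 - c)‖ ≤ E * (L * h) :=
    (norm_mul_le _ _).trans (mul_le_mul (hcp m (by omega)) hc1 (norm_nonneg _)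
      (zero_le_one.trans hE))
  rw [hsplit]
  calc _ ≤ (E * K * h) * (L * h) * E + E * (K * h ^ 2) * E + E * (h * L) * (E * K * h)
        + E * (h * L) * (E * (L * h)) := by
        refine (norm_add_le _ _).trans (add_le_add ((norm_add_le _ _).trans (add_le_add
          ((norm_add_le _ _).trans (add_le_add ?_ ?_)) ?_)) ?_)
        · exact norm_mul_mul_le (hsub k (by omega)) hZ (hbp m (by omega))
        · exact norm_mul_mul_le (hcp k (by omega)) hZD (hbp m (by omega))
        · exact norm_mul_mul_le (hcp k (by omega)) hhD (hsub m (by omega))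
        · exact norm_mul_mul_le (hcp k (by omega)) hhD hcm
    _ = _ := by ring

variable [CompleteSpace 𝔸]

theorem hasSum_exp (T : 𝔸) :
    HasSum (fun n : ℕ => ((n.factorial : ℝ)⁻¹) • T ^ n) (NormedSpace.exp T) :=
  NormedSpace.exp_series_hasSum_exp' (𝕂 := ℝ) T

theorem norm_exp_le (h1 : ‖(1 : 𝔸)‖ ≤ 1) (T : 𝔸) : ‖NormedSpace.exp T‖ ≤ Real.exp ‖T‖ := by
  have hr := hasSum_exp (𝔸 := ℝ) ‖T‖
  rw [← Real.exp_eq_exp_ℝ] at hr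
  rw [← (hasSum_exp T).tsum_eq]
  refine tsum_of_norm_bounded hr fun n => ?_
  rw [norm_smul, smul_eq_mul, Real.norm_of_nonneg (by positivity)]
  gcongr
  exact norm_pow_le_of_norm_one_le h1 T n

/-- Dropping two terms shifts the series by two; (n + 2)! ≥ n! then lets ‖T‖² be factored out. -/
theorem norm_exp_sub_one_sub_le (h1 : ‖(1 : 𝔸)‖ ≤ 1) (T : 𝔸) :
    ‖NormedSpace.exp T - 1 - T‖ ≤ ‖T‖ ^ 2 * Real.exp ‖T‖ := by
  have hr := (hasSum_exp (𝔸 := ℝ) ‖T‖).mul_left (‖T‖ ^ 2)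
  rw [← Real.exp_eq_exp_ℝ] at hr
  have hs := (hasSum_nat_add_iff' 2).2 (hasSum_exp T)
  simp only [Finset.sum_range_succ, Finset.sum_range_zero, Nat.factorial_zero, Nat.cast_one,
    inv_one, pow_zero, one_smul, Nat.factorial_one, pow_one, zero_add, ← sub_sub] at hs
  rw [← hs.tsum_eq]
  refine tsum_of_norm_bounded hr fun n => ?_
  rw [norm_smul, smul_eq_mul, Real.norm_of_nonneg (by positivity)]
  calc ((n + 2).factorial : ℝ)⁻¹ * ‖T ^ (n + 2)‖
      ≤ ((n.factorial : ℝ)⁻¹) * ‖T‖ ^ (n + 2) := by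
        gcongr
        · exact Nat.le_add_right n 2
        · exact norm_pow_le_of_norm_one_le h1 T _
    _ = ‖T‖ ^ 2 * ((n.factorial : ℝ)⁻¹ * ‖T‖ ^ n) := by ring

theorem exp_inv_smul_pow (M : 𝔸) {n : ℕ} (k : ℕ) :
    NormedSpace.exp ((n : ℝ)⁻¹ • M) ^ k = NormedSpace.exp (((k : ℝ) / n) • M) := by
  let : NormedAlgebra ℚ 𝔸 := NormedAlgebra.restrictScalars ℚ ℝ 𝔸
  rw [← NormedSpace.exp_nsmul, ← Nat.cast_smul_eq_nsmul ℝ, smul_smul, div_eq_mul_inv]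

end ExpBounds

/-! ### Telescoping of noncommutative products. -/

section Telescoping

variable {R : Type*} [Ring R]

/-- The random prefix stands on the left of B_k - b and only powers of b on the right. With b the
mean of an independent B_k, each summand is therefore a martingale difference. -/
theorem sum_prod_sub_pow_mul (B : ℕ → R) (b : R) (n : ℕ) :
    ∑ k ∈ Finset.range n, (((List.range k).map B).prod - b ^ k) * (B k - b) * b ^ (n - 1 - k) =
      ((List.range n).map B).prod - b ^ n -
        ∑ k ∈ Finset.range n, b ^ k * (B k - b) * b ^ (n - 1 - k) := by
  rw [eq_sub_iff_add_eq, ← Finset.sum_add_distrib]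
  have : ∀ k ∈ Finset.range n, (((List.range k).map B).prod - b ^ k) * (B k - b) * b ^ (n - 1 - k)
      + b ^ k * (B k - b) * b ^ (n - 1 - k) =
      ((List.range (k + 1)).map B).prod * b ^ (n - (k + 1)) -
        ((List.range k).map B).prod * b ^ (n - k) := by
    intro k hk
    have hk := Finset.mem_range.1 hk
    have h1 : n - (k + 1) = n - 1 - k := by omega
    have h2 : n - k = (n - 1 - k) + 1 := by omega
    rw [h1, h2, List.range_succ, List.map_append, List.prod_append, pow_succ']
    simp only [List.map_cons, List.map_nil, List.prod_cons, List.prod_nil]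
    noncomm_ring
  rw [Finset.sum_congr rfl this,
    Finset.sum_range_sub (fun k => ((List.range k).map B).prod * b ^ (n - k))]
  simp

end Telescoping

/-! ### Orthogonality of martingale increments and second moments. -/

section Martingale

variable {H : Type*} [NormedAddCommGroup H] [InnerProductSpace ℝ H]
  {Ω : Type*} {mΩ : MeasurableSpace Ω} {P : Measure Ω}

theorem stronglyMeasurable_apply {m : MeasurableSpace Ω} {T : Ω → H →L[ℝ] H} {V : Ω → H}
    (hT : StronglyMeasurable[m] T) (hV : StronglyMeasurable[m] V) :
    StronglyMeasurable[m] fun ω => T ω (V ω) :=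
  isBoundedBilinearMap_apply.continuous.comp_stronglyMeasurable (hT.prodMk hV)

/-- The map T ↦ ⟪U, T V⟫ is an m-measurable bounded functional, so it can be pulled out of the
conditional expectation of Z, which vanishes. -/
theorem integral_inner_apply_eq_zero [CompleteSpace H] [IsFiniteMeasure P] {m : MeasurableSpace Ω}
    (hm : m ≤ mΩ) {U V : Ω → H} {Z : Ω → H →L[ℝ] H} (hU : StronglyMeasurable[m] U)
    (hV : StronglyMeasurable[m] V) {c d : ℝ} (hUc : ∀ ω, ‖U ω‖ ≤ c) (hVd : ∀ ω, ‖V ω‖ ≤ d)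
    (hZ : Integrable Z P) (hZ0 : P[Z | m] =ᵐ[P] 0) : ∫ ω, ⟪U ω, Z ω (V ω)⟫_ℝ ∂P = 0 := by
  let W : Ω → (H →L[ℝ] H) →L[ℝ] ℝ := fun ω =>
    (innerSL ℝ (U ω)) ∘L (ContinuousLinearMap.apply ℝ H (V ω))
  have hcont : Continuous fun p : H × H =>
      (innerSL ℝ p.1) ∘L (ContinuousLinearMap.apply ℝ H p.2 : (H →L[ℝ] H) →L[ℝ] H) := by
    have h2 : Continuous fun p : H × H =>
        (ContinuousLinearMap.apply ℝ H p.2 : (H →L[ℝ] H) →L[ℝ] H) :=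
      (ContinuousLinearMap.apply ℝ H : H →L[ℝ] (H →L[ℝ] H) →L[ℝ] H).continuous.comp continuous_snd
    exact ((innerSL ℝ).continuous.comp continuous_fst).clm_comp h2
  have hW : StronglyMeasurable[m] W := hcont.comp_stronglyMeasurable (hU.prodMk hV)
  have hWb : ∀ ω, ‖W ω‖ ≤ c * d := fun ω => by
    have hc : 0 ≤ c := (norm_nonneg _).trans (hUc ω)
    have hd : 0 ≤ d := (norm_nonneg _).trans (hVd ω)
    refine ContinuousLinearMap.opNorm_le_bound _ (by positivity) fun T => ?_
    calc ‖⟪U ω, T (V ω)⟫_ℝ‖ ≤ ‖U ω‖ * (‖T‖ * ‖V ω‖) :=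
          (norm_inner_le_norm _ _).trans (by gcongr; exact T.le_opNorm _)
      _ ≤ c * (‖T‖ * d) := by gcongr; exacts [hUc ω, hVd ω]
      _ = c * d * ‖T‖ := by ring
  have key := condExp_stronglyMeasurable_bilin_of_bound (f := W) (g := Z) (μ := P)
    (ContinuousLinearMap.id ℝ ((H →L[ℝ] H) →L[ℝ] ℝ)) hm hW hZ (c * d) (Eventually.of_forall hWb)
  calc ∫ ω, ⟪U ω, Z ω (V ω)⟫_ℝ ∂P
      = ∫ ω, (P[fun ω => ContinuousLinearMap.id ℝ ((H →L[ℝ] H) →L[ℝ] ℝ) (W ω) (Z ω) | m]) ω ∂P :=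
        (integral_condExp hm).symm
    _ = ∫ _, (0 : ℝ) ∂P := by
        refine integral_congr_ae ?_
        filter_upwards [key, hZ0] with ω h1 h2
        rw [h1, h2, Pi.zero_apply, map_zero]
    _ = 0 := integral_zero _ _

/-- The product `B 0 ω * ⋯ * B (k - 1) ω`. -/
def partialProd {R : Type*} [Monoid R] (B : ℕ → Ω → R) (k : ℕ) (ω : Ω) : R :=
  ((List.range k).map fun j => B j ω).prod

theorem partialProd_succ {R : Type*} [Monoid R] (B : ℕ → Ω → R) (k : ℕ) (ω : Ω) :
    partialProd B (k + 1) ω = partialProd B k ω * B k ω := by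
  simp [partialProd, List.range_succ]

variable {m : ℕ → MeasurableSpace Ω} {B : ℕ → Ω → H →L[ℝ] H} {b : H →L[ℝ] H} {β δ : ℝ}

theorem stronglyMeasurable_partialProd (hmono : Monotone m)
    (hBm : ∀ k, StronglyMeasurable[m (k + 1)] (B k)) (k : ℕ) :
    StronglyMeasurable[m k] (partialProd B k) := by
  induction k with
  | zero => exact stronglyMeasurable_const' fun _ _ => by simp [partialProd]
  | succ k ih =>
    have : partialProd B (k + 1) = partialProd B k * B k := funext (partialProd_succ B k)
    rw [this]
    exact (ih.mono (hmono k.le_succ)).mul (hBm k)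

theorem norm_partialProd_le (hβ : 1 ≤ β) (hB : ∀ k ω, ‖B k ω‖ ≤ β) (k : ℕ) (ω : Ω) :
    ‖partialProd B k ω‖ ≤ β ^ k := by
  induction k with
  | zero => exact ContinuousLinearMap.norm_id_le (𝕜 := ℝ) (E := H)
  | succ k ih =>
    rw [partialProd_succ, pow_succ]
    exact (norm_mul_le _ _).trans (mul_le_mul ih (hB k ω) (norm_nonneg _) (by positivity))

theorem integrable_inner_of_norm_le [IsFiniteMeasure P] {U V : Ω → H} {c d : ℝ}
    (hU : AEStronglyMeasurable U P) (hV : AEStronglyMeasurable V P) (hUc : ∀ ω, ‖U ω‖ ≤ c)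
    (hVd : ∀ ω, ‖V ω‖ ≤ d) : Integrable (fun ω => ⟪U ω, V ω⟫_ℝ) P := by
  refine Integrable.of_bound (C := c * d) (hU.inner hV) (ae_of_all _ fun ω => ?_)
  exact (norm_inner_le_norm _ _).trans
    (mul_le_mul (hUc ω) (hVd ω) (norm_nonneg _) ((norm_nonneg _).trans (hUc ω)))

theorem integrable_norm_sq_of_norm_le [IsFiniteMeasure P] {U : Ω → H} {c : ℝ}
    (hU : AEStronglyMeasurable U P) (hUc : ∀ ω, ‖U ω‖ ≤ c) :
    Integrable (fun ω => ‖U ω‖ ^ 2) P := by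
  simpa only [real_inner_self_eq_norm_sq] using integrable_inner_of_norm_le hU hU hUc hUc

variable [CompleteSpace H]

variable (B b) in
/-- The adjoint of `B 0 ⋯ B (k - 1) - b ^ k`, applied to `y`. -/
def adjointDefect (y : H) (k : ℕ) (ω : Ω) : H :=
  (ContinuousLinearMap.adjoint (partialProd B k ω - b ^ k)) y

/-- The defect at k + 1 is the defect at k times b, plus prefix times B_k - b. Under the adjoint
this becomes a recursion for vectors of H, where orthogonality is available, unlike for the operator
norm. -/
theorem adjointDefect_succ (y : H) (k : ℕ) (ω : Ω) :
    adjointDefect B b y (k + 1) ω =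
      ContinuousLinearMap.adjoint b (adjointDefect B b y k ω) +
        ContinuousLinearMap.adjoint (B k ω - b)
          (ContinuousLinearMap.adjoint (partialProd B k ω) y) := by
  have : partialProd B (k + 1) ω - b ^ (k + 1) =
      (partialProd B k ω - b ^ k) * b + partialProd B k ω * (B k ω - b) := by
    rw [partialProd_succ, pow_succ]
    noncomm_ring
  simp only [adjointDefect]
  rw [this, map_add, ContinuousLinearMap.mul_def, ContinuousLinearMap.mul_def,
    ContinuousLinearMap.adjoint_comp, ContinuousLinearMap.adjoint_comp]
  rfl

theorem stronglyMeasurable_adjoint_apply {m' : MeasurableSpace Ω} {T : Ω → H →L[ℝ] H}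
    (hT : StronglyMeasurable[m'] T) (y : H) :
    StronglyMeasurable[m'] fun ω => ContinuousLinearMap.adjoint (T ω) y := by
  have : Continuous fun T : H →L[ℝ] H => ContinuousLinearMap.adjoint T y :=
    (ContinuousLinearMap.apply ℝ H y).continuous.comp
      (ContinuousLinearMap.adjoint (𝕜 := ℝ) (E := H) (F := H)).continuous
  exact this.comp_stronglyMeasurable hT

theorem stronglyMeasurable_adjointDefect (hmono : Monotone m)
    (hBm : ∀ k, StronglyMeasurable[m (k + 1)] (B k)) (y : H) (k : ℕ) :
    StronglyMeasurable[m k] (adjointDefect B b y k) :=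
  stronglyMeasurable_adjoint_apply
    ((stronglyMeasurable_partialProd hmono hBm k).sub stronglyMeasurable_const) y

theorem norm_adjoint_apply_le {T : H →L[ℝ] H} {c : ℝ} (hT : ‖T‖ ≤ c) (y : H) :
    ‖ContinuousLinearMap.adjoint T y‖ ≤ c * ‖y‖ := by
  refine (ContinuousLinearMap.le_opNorm _ _).trans ?_
  rw [LinearIsometryEquiv.norm_map]
  gcongr

theorem norm_adjointDefect_le (hβ : 1 ≤ β) (hB : ∀ k ω, ‖B k ω‖ ≤ β) (hb : ‖b‖ ≤ β) (y : H)
    (k : ℕ) (ω : Ω) : ‖adjointDefect B b y k ω‖ ≤ 2 * β ^ k * ‖y‖ := by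
  refine norm_adjoint_apply_le ((norm_sub_le _ _).trans ?_) y
  have h1 := norm_partialProd_le hβ hB k ω
  have h2 := (norm_pow_le_of_norm_one_le (ContinuousLinearMap.norm_id_le (𝕜 := ℝ) (E := H)) b
    k).trans (pow_le_pow_left₀ (norm_nonneg _) hb k)
  linarith

variable [IsProbabilityMeasure P]

/-- Expanding the square of the recursion, the cross term has mean zero, so each step adds only a
term of order δ². The bound thus grows like kδ², where the triangle inequality would give k²δ². -/
theorem integral_norm_adjointDefect_sq_le (hmono : Monotone m) (hm : ∀ k, m k ≤ mΩ)
    (hBm : ∀ k, StronglyMeasurable[m (k + 1)] (B k))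
    (hcond : ∀ k, P[fun ω => B k ω - b | m k] =ᵐ[P] 0) (hβ : 1 ≤ β) (hB : ∀ k ω, ‖B k ω‖ ≤ β)
    (hb : ‖b‖ ≤ β) (hδ : ∀ k ω, ‖B k ω - b‖ ≤ δ) (y : H) (k : ℕ) :
    ∫ ω, ‖adjointDefect B b y k ω‖ ^ 2 ∂P ≤ k * δ ^ 2 * (β ^ k) ^ 2 * ‖y‖ ^ 2 := by
  have hW := fun k => stronglyMeasurable_adjointDefect (b := b) hmono hBm y k
  have hWb := norm_adjointDefect_le hβ hB hb y
  have hβ0 : 0 ≤ β := zero_le_one.trans hβ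
  induction k with
  | zero => simp [adjointDefect, partialProd]
  | succ k ih =>
    set W := adjointDefect B b y k with hWdef
    set u : Ω → H := fun ω => ContinuousLinearMap.adjoint (partialProd B k ω) y with hudef
    have hu : StronglyMeasurable[m k] u :=
      stronglyMeasurable_adjoint_apply (stronglyMeasurable_partialProd hmono hBm k) y
    have hub : ∀ ω, ‖u ω‖ ≤ β ^ k * ‖y‖ := fun ω =>
      norm_adjoint_apply_le (norm_partialProd_le hβ hB k ω) y
    set v : Ω → H := fun ω => ContinuousLinearMap.adjoint b (W ω) with hvdef
    have hv : StronglyMeasurable[m k] v :=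
      (ContinuousLinearMap.adjoint b).continuous.comp_stronglyMeasurable (hW k)
    have hvW : ∀ ω, ‖v ω‖ ≤ β * ‖W ω‖ := fun ω => norm_adjoint_apply_le hb (W ω)
    have hvb : ∀ ω, ‖v ω‖ ≤ β * (2 * β ^ k * ‖y‖) := fun ω =>
      (hvW ω).trans (by gcongr; exact hWb k ω)
    have hZm : StronglyMeasurable fun ω => B k ω - b :=
      ((hBm k).mono (hm (k + 1))).sub stronglyMeasurable_const
    have hZi : Integrable (fun ω => B k ω - b) P :=
      Integrable.of_bound hZm.aestronglyMeasurable δ (ae_of_all _ (hδ k))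
    -- Moving the adjoint of B_k - b across the inner product leaves u and v, which depend on the
    -- past only.
    have hcross : ∫ ω, ⟪u ω, (B k ω - b) (v ω)⟫_ℝ ∂P = 0 :=
      integral_inner_apply_eq_zero (hm k) hu hv hub hvb hZi (hcond k)
    have hZv : ∀ ω, ‖(B k ω - b) (v ω)‖ ≤ δ * (β * (2 * β ^ k * ‖y‖)) := fun ω =>
      ((B k ω - b).le_opNorm _).trans
        (mul_le_mul (hδ k ω) (hvb ω) (norm_nonneg _) ((norm_nonneg _).trans (hδ k ω)))
    have hpt : ∀ ω, ‖adjointDefect B b y (k + 1) ω‖ ^ 2 ≤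
        β ^ 2 * ‖W ω‖ ^ 2 + 2 * ⟪u ω, (B k ω - b) (v ω)⟫_ℝ + δ ^ 2 * (β ^ k * ‖y‖) ^ 2 := by
      intro ω
      rw [adjointDefect_succ, norm_add_sq_real, ContinuousLinearMap.adjoint_inner_right,
        real_inner_comm]
      have h1 : ‖v ω‖ ^ 2 ≤ β ^ 2 * ‖W ω‖ ^ 2 := by
        rw [← mul_pow]; exact pow_le_pow_left₀ (norm_nonneg _) (hvW ω) 2
      have h2 : ‖ContinuousLinearMap.adjoint (B k ω - b) (u ω)‖ ^ 2 ≤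
          δ ^ 2 * (β ^ k * ‖y‖) ^ 2 := by
        rw [← mul_pow]
        refine pow_le_pow_left₀ (norm_nonneg _) ((norm_adjoint_apply_le (hδ k ω) _).trans ?_) 2
        exact mul_le_mul_of_nonneg_left (hub ω) ((norm_nonneg _).trans (hδ k ω))
      exact add_le_add (add_le_add_left h1 _) h2
    have hi1 : Integrable (fun ω => ‖W ω‖ ^ 2) P :=
      integrable_norm_sq_of_norm_le ((hW k).mono (hm k)).aestronglyMeasurable (hWb k)
    have hi2 : Integrable (fun ω => ⟪u ω, (B k ω - b) (v ω)⟫_ℝ) P :=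
      integrable_inner_of_norm_le (hu.mono (hm k)).aestronglyMeasurable
        (stronglyMeasurable_apply hZm (hv.mono (hm k))).aestronglyMeasurable hub hZv
    have hi12 : Integrable (fun ω => β ^ 2 * ‖W ω‖ ^ 2 + 2 * ⟪u ω, (B k ω - b) (v ω)⟫_ℝ) P :=
      (hi1.const_mul (β ^ 2)).add (hi2.const_mul 2)
    calc ∫ ω, ‖adjointDefect B b y (k + 1) ω‖ ^ 2 ∂P
        ≤ ∫ ω, (β ^ 2 * ‖W ω‖ ^ 2 + 2 * ⟪u ω, (B k ω - b) (v ω)⟫_ℝ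
            + δ ^ 2 * (β ^ k * ‖y‖) ^ 2) ∂P := by
          refine integral_mono ?_ (hi12.add (integrable_const _)) hpt
          exact integrable_norm_sq_of_norm_le
            ((hW (k + 1)).mono (hm _)).aestronglyMeasurable (hWb _)
      _ = β ^ 2 * (∫ ω, ‖W ω‖ ^ 2 ∂P) + δ ^ 2 * (β ^ k * ‖y‖) ^ 2 := by
          rw [integral_add hi12 (integrable_const _),
            integral_add (hi1.const_mul _) (hi2.const_mul _), integral_const_mul,
            integral_const_mul, hcross]
          simp
      _ ≤ β ^ 2 * (k * δ ^ 2 * (β ^ k) ^ 2 * ‖y‖ ^ 2) + δ ^ 2 * (β ^ (k + 1) * ‖y‖) ^ 2 := by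
          gcongr
          · exact k.le_succ
      _ = ((k + 1 : ℕ) : ℝ) * δ ^ 2 * (β ^ (k + 1)) ^ 2 * ‖y‖ ^ 2 := by
          push_cast
          ring

/-- The second moment of the part of `B 0 ⋯ B (n - 1)` which is of order at least two in the
martingale increments `B k - b`. -/
theorem integral_sum_inner_adjointDefect_sq_le (hmono : Monotone m) (hm : ∀ k, m k ≤ mΩ)
    (hBm : ∀ k, StronglyMeasurable[m (k + 1)] (B k))
    (hcond : ∀ k, P[fun ω => B k ω - b | m k] =ᵐ[P] 0) (hβ : 1 ≤ β) (hB : ∀ k ω, ‖B k ω‖ ≤ β)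
    (hb : ‖b‖ ≤ β) (hδ : ∀ k ω, ‖B k ω - b‖ ≤ δ) (y : H) {v : ℕ → H} {V : ℝ}
    (hv : ∀ k, ‖v k‖ ≤ V) {n : ℕ} {j : ℕ} (hj : j ≤ n) :
    ∫ ω, (∑ k ∈ Finset.range j, ⟪adjointDefect B b y k ω, (B k ω - b) (v k)⟫_ℝ) ^ 2 ∂P ≤
      j * (n * δ ^ 2 * (β ^ n) ^ 2 * ‖y‖ ^ 2 * (δ * V) ^ 2) := by
  have hW := fun k => stronglyMeasurable_adjointDefect (b := b) hmono hBm y k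
  have hWb := norm_adjointDefect_le hβ hB hb y
  have hβ0 : 0 ≤ β := zero_le_one.trans hβ
  have hV : 0 ≤ V := (norm_nonneg _).trans (hv 0)
  have hZm : ∀ k, StronglyMeasurable[m (k + 1)] fun ω => B k ω - b := fun k =>
    (hBm k).sub stronglyMeasurable_const
  have hZb : ∀ k ω, ‖(B k ω - b) (v k)‖ ≤ δ * V := fun k ω =>
    ((B k ω - b).le_opNorm _).trans
      (mul_le_mul (hδ k ω) (hv k) (norm_nonneg _) ((norm_nonneg _).trans (hδ k ω)))
  set d : ℕ → Ω → ℝ := fun k ω => ⟪adjointDefect B b y k ω, (B k ω - b) (v k)⟫_ℝ with hd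
  have hdm : ∀ k, StronglyMeasurable[m (k + 1)] (d k) := fun k =>
    ((hW k).mono (hmono k.le_succ)).inner
      (stronglyMeasurable_apply (hZm k) stronglyMeasurable_const)
  have hdb : ∀ k ω, ‖d k ω‖ ≤ ‖adjointDefect B b y k ω‖ * (δ * V) := fun k ω =>
    (norm_inner_le_norm _ _).trans (mul_le_mul_of_nonneg_left (hZb k ω) (norm_nonneg _))
  induction j with
  | zero => simp
  | succ j ih =>
    set S : Ω → ℝ := fun ω => ∑ k ∈ Finset.range j, d k ω with hS
    have hδV : ∀ ω : Ω, 0 ≤ δ * V := fun ω => (norm_nonneg _).trans (hZb 0 ω)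
    have hSm : StronglyMeasurable[m j] S :=
      Finset.stronglyMeasurable_fun_sum _ fun k hk =>
        (hdm k).mono (hmono (Nat.succ_le_of_lt (Finset.mem_range.1 hk)))
    -- This crude deterministic bound serves only boundedness and integrability; it does not enter
    -- the final estimate.
    set s := ∑ k ∈ Finset.range j, 2 * β ^ k * ‖y‖ * (δ * V) with hs
    have hSb : ∀ ω, ‖S ω‖ ≤ s := fun ω =>
      norm_sum_le_of_le _ fun k _ => (hdb k ω).trans
        (mul_le_mul_of_nonneg_right (hWb k ω) (hδV ω))
    have hSW : StronglyMeasurable[m j] fun ω => S ω • adjointDefect B b y j ω := hSm.smul (hW j)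
    have hSWb : ∀ ω, ‖S ω • adjointDefect B b y j ω‖ ≤ s * (2 * β ^ j * ‖y‖) := fun ω => by
      rw [norm_smul]
      exact mul_le_mul (hSb ω) (hWb j ω) (norm_nonneg _) ((norm_nonneg _).trans (hSb ω))
    have hZi : Integrable (fun ω => B j ω - b) P :=
      Integrable.of_bound ((hZm j).mono (hm _)).aestronglyMeasurable δ (ae_of_all _ (hδ j))
    -- The scalar S is absorbed into the defect vector, so that S · d_j has the form ⟪past, (B_j -
    -- b) v_j⟫.
    have hcross : ∫ ω, S ω * d j ω ∂P = 0 := by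
      have := integral_inner_apply_eq_zero (hm j) hSW stronglyMeasurable_const hSWb
        (fun _ => hv j) hZi (hcond j)
      simpa only [real_inner_smul_left] using this
    have hi1 : Integrable (fun ω => S ω ^ 2) P := by
      simpa using integrable_norm_sq_of_norm_le (hSm.mono (hm j)).aestronglyMeasurable hSb
    have hi2 : Integrable (fun ω => S ω * d j ω) P := by
      have := integrable_inner_of_norm_le (P := P) (hSW.mono (hm j)).aestronglyMeasurable
        ((stronglyMeasurable_apply (hZm j) (stronglyMeasurable_const (b := v j))).mono
          (hm _)).aestronglyMeasurable hSWb (hZb j)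
      simpa only [real_inner_smul_left] using this
    have hi3 : Integrable (fun ω => ‖adjointDefect B b y j ω‖ ^ 2) P :=
      integrable_norm_sq_of_norm_le ((hW j).mono (hm j)).aestronglyMeasurable (hWb j)
    have hi12 : Integrable (fun ω => S ω ^ 2 + 2 * (S ω * d j ω)) P := hi1.add (hi2.const_mul 2)
    have hi4 := hi3.mul_const ((δ * V) ^ 2)
    have hpt : ∀ ω, (∑ k ∈ Finset.range (j + 1), d k ω) ^ 2 ≤
        S ω ^ 2 + 2 * (S ω * d j ω) + ‖adjointDefect B b y j ω‖ ^ 2 * (δ * V) ^ 2 := fun ω => by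
      rw [Finset.sum_range_succ, add_sq, mul_assoc, ← mul_pow]
      refine add_le_add_right ?_ _
      rw [← sq_abs (d j ω)]
      exact pow_le_pow_left₀ (abs_nonneg _) (hdb j ω) 2
    calc ∫ ω, (∑ k ∈ Finset.range (j + 1), d k ω) ^ 2 ∂P
        ≤ ∫ ω, (S ω ^ 2 + 2 * (S ω * d j ω)
            + ‖adjointDefect B b y j ω‖ ^ 2 * (δ * V) ^ 2) ∂P :=
          integral_mono_of_nonneg (ae_of_all _ fun ω => sq_nonneg _) (hi12.add hi4)
            (ae_of_all _ hpt)
      _ = (∫ ω, S ω ^ 2 ∂P) + (∫ ω, ‖adjointDefect B b y j ω‖ ^ 2 ∂P) * (δ * V) ^ 2 := by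
          rw [integral_add hi12 hi4, integral_add hi1 (hi2.const_mul _), integral_const_mul,
            hcross, integral_mul_const]
          simp
      _ ≤ j * (n * δ ^ 2 * (β ^ n) ^ 2 * ‖y‖ ^ 2 * (δ * V) ^ 2) +
            n * δ ^ 2 * (β ^ n) ^ 2 * ‖y‖ ^ 2 * (δ * V) ^ 2 := by
          refine add_le_add (ih (by omega)) (mul_le_mul_of_nonneg_right ?_ (sq_nonneg _))
          refine (integral_norm_adjointDefect_sq_le hmono hm hBm hcond hβ hB hb hδ y j).trans ?_
          gcongr <;> omega
      _ = _ := by push_cast; ring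

end Martingale

/-! ### Left Riemann sums of a continuous function. -/

section Riemann

theorem tendsto_riemannSum {g : ℝ → ℝ} (hg : Continuous g) :
    Tendsto (fun n : ℕ => ∑ k ∈ Finset.range n, (n : ℝ)⁻¹ * g ((k : ℝ) / n)) atTop
      (𝓝 (∫ s in (0 : ℝ)..1, g s)) := by
  have huc : UniformContinuousOn g (Set.Icc 0 1) :=
    isCompact_Icc.uniformContinuousOn_of_continuous hg.continuousOn
  rw [Metric.tendsto_atTop]
  intro ε hε
  obtain ⟨δ, hδ, hδg⟩ := Metric.uniformContinuousOn_iff.1 huc (ε / 2) (half_pos hε)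
  obtain ⟨N, hN⟩ := exists_nat_gt δ⁻¹
  refine ⟨N + 1, fun n hn => ?_⟩
  have hn0 : (0 : ℝ) < n := by exact_mod_cast (by omega : 0 < n)
  have hnδ : (n : ℝ)⁻¹ < δ := by
    refine inv_lt_of_inv_lt₀ hδ (hN.trans ?_)
    exact_mod_cast (by omega : N < n)
  have hsum : ∫ s in (0 : ℝ)..1, g s =
      ∑ k ∈ Finset.range n, ∫ s in ((k : ℝ) / n)..(((k + 1 : ℕ) : ℝ) / n), g s := by
    rw [intervalIntegral.sum_integral_adjacent_intervals (a := fun k : ℕ => (k : ℝ) / n)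
      fun k _ => hg.intervalIntegrable _ _]
    simp [div_self hn0.ne']
  have hlen : ∀ k : ℕ, ((k + 1 : ℕ) : ℝ) / n - (k : ℝ) / n = (n : ℝ)⁻¹ := fun k => by
    push_cast; field_simp; ring
  rw [hsum, Real.dist_eq, ← Finset.sum_sub_distrib]
  have hterm : ∀ k ∈ Finset.range n, |(n : ℝ)⁻¹ * g ((k : ℝ) / n) -
      ∫ s in ((k : ℝ) / n)..(((k + 1 : ℕ) : ℝ) / n), g s| ≤ ε / 2 * (n : ℝ)⁻¹ := by
    intro k hk
    have hk := Finset.mem_range.1 hk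
    have hconst : (n : ℝ)⁻¹ * g ((k : ℝ) / n) =
        ∫ _ in ((k : ℝ) / n)..(((k + 1 : ℕ) : ℝ) / n), g ((k : ℝ) / n) := by
      rw [intervalIntegral.integral_const, hlen, smul_eq_mul]
    have hle : (k : ℝ) / n ≤ ((k + 1 : ℕ) : ℝ) / n := by
      have := hlen k
      have := inv_pos.2 hn0
      linarith
    have hk1 : ((k + 1 : ℕ) : ℝ) / n ≤ 1 := by
      rw [div_le_one hn0]
      exact_mod_cast hk
    have hk0 : 0 ≤ (k : ℝ) / n := by positivity
    rw [hconst, ← intervalIntegral.integral_sub intervalIntegrable_const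
      (hg.intervalIntegrable _ _), ← Real.norm_eq_abs]
    refine (intervalIntegral.norm_integral_le_of_norm_le_const (C := ε / 2) fun s hs => ?_).trans ?_
    · rw [Set.uIoc_of_le hle] at hs
      refine (hδg _ ⟨hk0, hle.trans hk1⟩ s ⟨hk0.trans hs.1.le, hs.2.trans hk1⟩ ?_).le
      rw [Real.dist_eq, abs_sub_comm, abs_of_nonneg (sub_nonneg.2 hs.1.le)]
      have := hlen k
      linarith [hs.2]
    · rw [hlen, abs_of_pos (inv_pos.2 hn0)]
  calc _ ≤ ∑ k ∈ Finset.range n, ε / 2 * (n : ℝ)⁻¹ :=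
        (Finset.abs_sum_le_sum_abs _ _).trans (Finset.sum_le_sum hterm)
    _ = ε / 2 := by
        rw [Finset.sum_const, Finset.card_range, nsmul_eq_mul]
        field_simp
    _ < ε := half_lt_self hε

end Riemann

/-! ### Characteristic functions and the triangular central limit theorem. -/

section TriangularCLT

theorem norm_cexp_ofReal_mul_I_sub_le {x r : ℝ} (hx : |x| ≤ r) :
    ‖Complex.exp (x * Complex.I) - (1 + x * Complex.I - x ^ 2 / 2)‖ ≤ r ^ 3 * Real.exp r := by
  have h := Complex.norm_exp_sub_sum_le_norm_mul_exp (x * Complex.I) 3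
  have hn : ‖(x : ℂ) * Complex.I‖ = |x| := by simp
  have hs : ∑ m ∈ Finset.range 3, ((x : ℂ) * Complex.I) ^ m / (m.factorial : ℂ) =
      1 + x * Complex.I - x ^ 2 / 2 := by
    simp [Finset.sum_range_succ, Nat.factorial, mul_pow, Complex.I_sq]
    ring
  rw [hs, hn] at h
  have hr : 0 ≤ r := (abs_nonneg x).trans hx
  refine h.trans ?_
  gcongr

variable {Ω : Type*} [MeasurableSpace Ω] {P : Measure Ω} [IsProbabilityMeasure P]

/-- Both quantities are compared with 1 - t²v/2, where v is the variance: the characteristic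
function by a third order Taylor bound and vanishing mean, the Gaussian factor by a second order
bound and v ≤ r². -/
theorem norm_charFun_sub_exp_le {ξ : Ω → ℝ} (hξ : AEMeasurable ξ P) {r : ℝ} (hr : ∀ ω, |ξ ω| ≤ r)
    (h0 : ∫ ω, ξ ω ∂P = 0) (t : ℝ) :
    ‖charFun (P.map ξ) t - Complex.exp ((-(t ^ 2 * (∫ ω, ξ ω ^ 2 ∂P) / 2) : ℝ))‖ ≤
      (|t| * r) ^ 3 * Real.exp (|t| * r) + (|t| * r) ^ 4 * Real.exp ((|t| * r) ^ 2) := by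
  set v := ∫ ω, ξ ω ^ 2 ∂P with hv
  obtain ⟨ω₀⟩ := P.nonempty_of_neZero
  have hr0 : 0 ≤ r := (abs_nonneg _).trans (hr ω₀)
  have hξi : Integrable ξ P := Integrable.of_bound hξ.aestronglyMeasurable r (ae_of_all _ hr)
  have hξ2 : ∀ ω, ξ ω ^ 2 ≤ r ^ 2 := fun ω => by
    rw [← sq_abs]; exact pow_le_pow_left₀ (abs_nonneg _) (hr ω) 2
  have hξ2i : Integrable (fun ω => ξ ω ^ 2) P :=
    Integrable.of_bound (hξ.pow_const 2).aestronglyMeasurable (r ^ 2) (ae_of_all _ fun ω => by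
      rw [Real.norm_of_nonneg (sq_nonneg _)]; exact hξ2 ω)
  have hv0 : 0 ≤ v := integral_nonneg fun ω => sq_nonneg _
  have hvr : v ≤ r ^ 2 := by
    calc v ≤ ∫ _, r ^ 2 ∂P := integral_mono hξ2i (integrable_const _) hξ2
      _ = r ^ 2 := by simp
  have hφ : charFun (P.map ξ) t = ∫ ω, Complex.exp (((t * ξ ω : ℝ) : ℂ) * Complex.I) ∂P := by
    rw [charFun_apply_real, integral_map hξ (by fun_prop)]
    simp
  have e1 : ∀ ω, (1 + ((t * ξ ω : ℝ) : ℂ) * Complex.I - ((t * ξ ω : ℝ) : ℂ) ^ 2 / 2) =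
      1 + ((ξ ω : ℝ) : ℂ) * (t * Complex.I) - ((ξ ω ^ 2 : ℝ) : ℂ) * (t ^ 2 / 2) := fun ω => by
    push_cast; ring
  have i1 : Integrable (fun ω => ((ξ ω : ℝ) : ℂ) * (t * Complex.I)) P :=
    hξi.ofReal.mul_const _
  have i2 : Integrable (fun ω => ((ξ ω ^ 2 : ℝ) : ℂ) * (t ^ 2 / 2)) P :=
    hξ2i.ofReal.mul_const _
  have i3 : Integrable (fun ω => 1 + ((ξ ω : ℝ) : ℂ) * (t * Complex.I)) P :=
    (integrable_const _).add i1
  have hpoly : ∫ ω, (1 + ((t * ξ ω : ℝ) : ℂ) * Complex.I - ((t * ξ ω : ℝ) : ℂ) ^ 2 / 2) ∂P =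
      1 - ((t ^ 2 * v / 2 : ℝ) : ℂ) := by
    simp_rw [e1]
    rw [integral_sub i3 i2, integral_add (integrable_const _) i1, integral_mul_const,
      integral_mul_const, integral_complex_ofReal, integral_complex_ofReal, h0, ← hv]
    simp
    ring
  have habs : ∀ ω, |t * ξ ω| ≤ |t| * r := fun ω => by
    rw [abs_mul]; exact mul_le_mul_of_nonneg_left (hr ω) (abs_nonneg _)
  have hmeas : AEMeasurable (fun ω => ((t * ξ ω : ℝ) : ℂ)) P :=
    Complex.measurable_ofReal.comp_aemeasurable (hξ.const_mul t)
  have hi1 : Integrable (fun ω => Complex.exp (((t * ξ ω : ℝ) : ℂ) * Complex.I)) P := by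
    refine Integrable.of_bound (C := 1) ?_ (ae_of_all _ fun ω => ?_)
    · exact (Complex.measurable_exp.comp_aemeasurable (hmeas.mul_const _)).aestronglyMeasurable
    · rw [Complex.norm_exp_ofReal_mul_I]
  have hi2 : Integrable
      (fun ω => (1 + ((t * ξ ω : ℝ) : ℂ) * Complex.I - ((t * ξ ω : ℝ) : ℂ) ^ 2 / 2)) P :=
    (i3.sub i2).congr (ae_of_all _ fun ω => (e1 ω).symm)
  have h1 : ‖charFun (P.map ξ) t - (1 - ((t ^ 2 * v / 2 : ℝ) : ℂ))‖ ≤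
      (|t| * r) ^ 3 * Real.exp (|t| * r) := by
    rw [hφ, ← hpoly, ← integral_sub hi1 hi2]
    refine (norm_integral_le_of_norm_le_const (ae_of_all _ fun ω =>
      norm_cexp_ofReal_mul_I_sub_le (habs ω))).trans ?_
    simp
  have h2 : ‖(1 - ((t ^ 2 * v / 2 : ℝ) : ℂ)) - Complex.exp ((-(t ^ 2 * v / 2) : ℝ))‖ ≤
      (|t| * r) ^ 4 * Real.exp ((|t| * r) ^ 2) := by
    have h := Complex.norm_exp_sub_sum_le_norm_mul_exp ((-(t ^ 2 * v / 2) : ℝ) : ℂ) 2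
    have hs : ∑ m ∈ Finset.range 2, ((-(t ^ 2 * v / 2) : ℝ) : ℂ) ^ m / (m.factorial : ℂ) =
        1 - ((t ^ 2 * v / 2 : ℝ) : ℂ) := by
      simp [Finset.sum_range_succ, sub_eq_add_neg]
    have hle : ‖((-(t ^ 2 * v / 2) : ℝ) : ℂ)‖ ≤ (|t| * r) ^ 2 := by
      rw [Complex.norm_real, norm_neg, Real.norm_of_nonneg (by positivity), mul_pow, sq_abs]
      have : t ^ 2 * v ≤ t ^ 2 * r ^ 2 := by gcongr
      have : 0 ≤ t ^ 2 * v := by positivity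
      linarith
    rw [hs, norm_sub_rev] at h
    refine h.trans ?_
    calc _ ≤ ((|t| * r) ^ 2) ^ 2 * Real.exp ((|t| * r) ^ 2) := by gcongr
      _ = _ := by ring
  calc _ ≤ _ := norm_sub_le_norm_sub_add_norm_sub _ (1 - ((t ^ 2 * v / 2 : ℝ) : ℂ)) _
    _ ≤ _ := add_le_add h1 h2

/-- Factors in the closed unit disc are exchanged one at a time, so the errors add without
amplification. -/
theorem norm_prod_sub_prod_le {ι : Type*} (s : Finset ι) {a b : ι → ℂ} (ha : ∀ i ∈ s, ‖a i‖ ≤ 1)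
    (hb : ∀ i ∈ s, ‖b i‖ ≤ 1) : ‖∏ i ∈ s, a i - ∏ i ∈ s, b i‖ ≤ ∑ i ∈ s, ‖a i - b i‖ := by
  classical
  induction s using Finset.induction_on with
  | empty => simp
  | insert i s hi ih =>
    rw [Finset.prod_insert hi, Finset.prod_insert hi, Finset.sum_insert hi]
    have hsplit : a i * ∏ j ∈ s, a j - b i * ∏ j ∈ s, b j =
        (a i - b i) * ∏ j ∈ s, a j + b i * (∏ j ∈ s, a j - ∏ j ∈ s, b j) := by ring
    have hA : ‖∏ j ∈ s, a j‖ ≤ 1 := by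
      rw [norm_prod]
      exact Finset.prod_le_one (fun _ _ => norm_nonneg _)
        fun j hj => ha j (Finset.mem_insert_of_mem hj)
    have hB := hb i (Finset.mem_insert_self i s)
    have hI := ih (fun j hj => ha j (Finset.mem_insert_of_mem hj))
      (fun j hj => hb j (Finset.mem_insert_of_mem hj))
    rw [hsplit]
    refine (norm_add_le _ _).trans ?_
    rw [norm_mul, norm_mul]
    refine add_le_add (mul_le_of_le_one_right (norm_nonneg _) hA) ?_
    exact (mul_le_of_le_one_left (norm_nonneg _) hB).trans hI

/-- **Central limit theorem** for a triangular array of centred independent random variables of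
order `1 / √n`. -/
theorem tendstoInDistribution_sum_triangular {ξ : ℕ → ℕ → Ω → ℝ}
    (hξ : ∀ n k, AEMeasurable (ξ n k) P) (hindep : ∀ n, iIndepFun (ξ n) P) {K : ℝ}
    (hK : ∀ n, ∀ k < n, ∀ ω, |ξ n k ω| ≤ K * (√n)⁻¹) (h0 : ∀ n k, ∫ ω, ξ n k ω ∂P = 0) {v : ℝ}
    (hv : Tendsto (fun n => ∑ k ∈ Finset.range n, ∫ ω, ξ n k ω ^ 2 ∂P) atTop (𝓝 v)) :
    TendstoInDistribution (fun n ω => ∑ k ∈ Finset.range n, ξ n k ω) atTop (id : ℝ → ℝ)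
      (fun _ => P) (gaussianReal 0 v.toNNReal) where
  forall_aemeasurable n := Finset.aemeasurable_fun_sum _ fun k _ => hξ n k
  tendsto := by
    -- As a limit of sums of second moments v is nonnegative, so `toNNReal` does not truncate it.
    have hv0 : 0 ≤ v := ge_of_tendsto' hv fun n =>
      Finset.sum_nonneg fun k _ => integral_nonneg fun ω => sq_nonneg _
    refine ProbabilityMeasure.tendsto_iff_tendsto_charFun.2 fun t => ?_
    simp only [ProbabilityMeasure.coe_mk, Measure.map_id, charFun_gaussianReal]
    have hprod : ∀ n, charFun (P.map fun ω => ∑ k ∈ Finset.range n, ξ n k ω) t =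
        ∏ k ∈ Finset.range n, charFun (P.map (ξ n k)) t := fun n => by
      rw [((hindep n).restrict _).charFun_map_fun_finsetSum_eq_prod fun k _ => hξ n k]
      simp
    simp only [hprod]
    set r : ℕ → ℝ := fun n => |t| * (K * (√n)⁻¹) with hr
    have hmain : Tendsto (fun n : ℕ => ∏ k ∈ Finset.range n,
        Complex.exp ((-(t ^ 2 * (∫ ω, ξ n k ω ^ 2 ∂P) / 2) : ℝ))) atTop
        (𝓝 (Complex.exp (t * ((0 : ℝ) : ℂ) * Complex.I - v.toNNReal * t ^ 2 / 2))) := by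
      simp_rw [← Complex.exp_sum]
      refine (Complex.continuous_exp.tendsto _).comp ?_
      have : Tendsto (fun n => ((-(t ^ 2 / 2 * ∑ k ∈ Finset.range n, ∫ ω, ξ n k ω ^ 2 ∂P) : ℝ) : ℂ))
          atTop (𝓝 ((-(t ^ 2 / 2 * v) : ℝ) : ℂ)) :=
        (Complex.continuous_ofReal.tendsto _).comp (hv.const_mul _).neg
      convert this using 2 with n
      · rw [Finset.mul_sum, ← Finset.sum_neg_distrib, Complex.ofReal_sum]
        refine Finset.sum_congr rfl fun k _ => ?_
        push_cast
        ring
      · have hvc : ((v.toNNReal : ℝ) : ℂ) = v := by rw [Real.coe_toNNReal v hv0]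
        rw [hvc]
        push_cast
        ring
    refine hmain.congr_dist (squeeze_zero
      (g := fun n : ℕ => n * (r n ^ 3 * Real.exp (r n) + r n ^ 4 * Real.exp (r n ^ 2)))
      (fun _ => dist_nonneg) (fun n => ?_) ?_)
    · rw [dist_comm, dist_eq_norm]
      refine (norm_prod_sub_prod_le _ (fun k _ => ?_) (fun k _ => ?_)).trans ?_
      · have := Measure.isProbabilityMeasure_map (hξ n k)
        exact norm_charFun_le_one t
      · rw [Complex.norm_exp_ofReal, Real.exp_le_one_iff]
        have : 0 ≤ ∫ ω, ξ n k ω ^ 2 ∂P := integral_nonneg fun ω => sq_nonneg _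
        have : 0 ≤ t ^ 2 * (∫ ω, ξ n k ω ^ 2 ∂P) / 2 := by positivity
        linarith
      · refine (Finset.sum_le_sum fun k hk =>
          norm_charFun_sub_exp_le (hξ n k) (hK n k (Finset.mem_range.1 hk)) (h0 n k) t).trans ?_
        rw [Finset.sum_const, Finset.card_range, nsmul_eq_mul]
    · have hinv : Tendsto (fun n : ℕ => (√(n : ℝ))⁻¹) atTop (𝓝 0) :=
        tendsto_inv_atTop_zero.comp
          (Real.tendsto_sqrt_atTop.comp tendsto_natCast_atTop_atTop)
      have hr0 : Tendsto r atTop (𝓝 0) := by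
        simpa using (hinv.const_mul K).const_mul |t|
      have hlim : Tendsto (fun n : ℕ => (|t| * K) ^ 2 *
          (r n * Real.exp (r n) + r n ^ 2 * Real.exp (r n ^ 2))) atTop (𝓝 0) := by
        have hc : Continuous fun x : ℝ => (|t| * K) ^ 2 *
            (x * Real.exp x + x ^ 2 * Real.exp (x ^ 2)) := by fun_prop
        simpa [Function.comp_def] using (hc.tendsto 0).comp hr0
      refine hlim.congr' ?_
      filter_upwards [eventually_gt_atTop 0] with n hn
      have hn' : (0 : ℝ) < n := by exact_mod_cast hn
      -- Since n r² is constant, n terms of order r³ and r⁴ sum to O(r), which tends to 0.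
      have hr2 : n * r n ^ 2 = (|t| * K) ^ 2 := by
        simp only [hr, mul_pow, inv_pow, Real.sq_sqrt hn'.le]
        field_simp
      rw [← hr2]
      ring

end TriangularCLT

/-! ### Taylor bounds for e^{hT}, uniform over ‖T‖ ≤ ρ. -/

section ExpTaylor

variable {𝔸 : Type*} [NormedRing 𝔸] [NormedAlgebra ℝ 𝔸] [CompleteSpace 𝔸]

theorem norm_exp_smul_le (h1 : ‖(1 : 𝔸)‖ ≤ 1) {T : 𝔸} {ρ h : ℝ} (hT : ‖T‖ ≤ ρ) (h0 : 0 ≤ h) :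
    ‖NormedSpace.exp (h • T)‖ ≤ Real.exp (h * ρ) := by
  refine (norm_exp_le h1 _).trans (Real.exp_le_exp.2 ?_)
  rw [norm_smul, Real.norm_of_nonneg h0]
  gcongr

theorem norm_exp_smul_sub_one_sub_le (h1 : ‖(1 : 𝔸)‖ ≤ 1) {T : 𝔸} {ρ h : ℝ} (hT : ‖T‖ ≤ ρ)
    (h0 : 0 ≤ h) (hle : h ≤ 1) :
    ‖NormedSpace.exp (h • T) - 1 - h • T‖ ≤ ρ ^ 2 * Real.exp ρ * h ^ 2 := by
  have hρ : 0 ≤ ρ := (norm_nonneg _).trans hT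
  have hn : ‖h • T‖ ≤ h * ρ := by
    rw [norm_smul, Real.norm_of_nonneg h0]
    gcongr
  have hn' : ‖h • T‖ ≤ ρ := hn.trans (mul_le_of_le_one_left hρ hle)
  calc _ ≤ ‖h • T‖ ^ 2 * Real.exp ‖h • T‖ := norm_exp_sub_one_sub_le h1 _
    _ ≤ (h * ρ) ^ 2 * Real.exp ρ := by gcongr
    _ = _ := by ring

end ExpTaylor

/-! ### Convergence in measure from second moments. -/

section SecondMoment

variable {Ω : Type*} [MeasurableSpace Ω] {P : Measure Ω}

theorem norm_integral_le_of_ae_norm_le [IsProbabilityMeasure P] {F : Type*}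
    [NormedAddCommGroup F] [NormedSpace ℝ F] {f : Ω → F} {C : ℝ} (h : ∀ᵐ ω ∂P, ‖f ω‖ ≤ C) :
    ‖∫ ω, f ω ∂P‖ ≤ C := by
  simpa using norm_integral_le_of_norm_le_const h

variable [IsFiniteMeasure P]

theorem tendstoInMeasure_zero_of_integral_sq {f : ℕ → Ω → ℝ}
    (hf : ∀ n, Integrable (fun ω => f n ω ^ 2) P)
    (h : Tendsto (fun n => ∫ ω, f n ω ^ 2 ∂P) atTop (𝓝 0)) : TendstoInMeasure P f atTop 0 := by
  rw [tendstoInMeasure_iff_measureReal_norm]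
  intro ε hε
  have hlim : Tendsto (fun n => (∫ ω, f n ω ^ 2 ∂P) / ε ^ 2) atTop (𝓝 0) := by
    simpa using h.div_const (ε ^ 2)
  refine squeeze_zero (fun _ => measureReal_nonneg) (fun n => ?_) hlim
  rw [le_div_iff₀ (by positivity), mul_comm]
  refine le_trans ?_ (mul_meas_ge_le_integral_of_nonneg
    (ae_of_all _ fun ω => sq_nonneg (f n ω)) (hf n) (ε ^ 2))
  refine mul_le_mul_of_nonneg_left (measureReal_mono fun ω hω => ?_) (by positivity)
  have hω' : ε ≤ |f n ω| := by simpa using hω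
  simpa only [Set.mem_ofPred_eq, sq_abs] using pow_le_pow_left₀ hε.le hω' 2

end SecondMoment

/-! ### The filtration generated by the sequence. -/

section PastSigmaAlgebra

variable {Ω E : Type*} [mE : MeasurableSpace E]

/-- The σ-algebra generated by `X 0, …, X (k - 1)`. -/
@[reducible]
def past (X : ℕ → Ω → E) (k : ℕ) : MeasurableSpace Ω :=
  ⨆ j ∈ {j | j < k}, MeasurableSpace.comap (X j) mE

theorem monotone_past (X : ℕ → Ω → E) : Monotone (past X) := fun _ _ hkl =>
  biSup_mono fun _ hj => lt_of_lt_of_le hj hkl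

theorem comap_le_past_succ (X : ℕ → Ω → E) (k : ℕ) :
    MeasurableSpace.comap (X k) mE ≤ past X (k + 1) :=
  le_biSup (fun j => MeasurableSpace.comap (X j) mE) (Nat.lt_succ_self k)

variable [mΩ : MeasurableSpace Ω] {P : Measure Ω}

theorem past_le {X : ℕ → Ω → E} (hX : ∀ k, Measurable (X k)) (k : ℕ) : past X k ≤ mΩ :=
  iSup₂_le fun j _ => (hX j).comap_le

theorem indep_comap_past {X : ℕ → Ω → E} (hX : ∀ k, Measurable (X k)) (hind : iIndepFun X P)
    (k : ℕ) : Indep (MeasurableSpace.comap (X k) mE) (past X k) P := by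
  have h := indep_iSup_of_disjoint (fun j => (hX j).comap_le) hind
    (S := {k}) (T := {j | j < k}) (by simp)
  rwa [iSup_singleton] at h

/-- The operator space need not be separable, so measurability alone is not enough. Separability of
the range does not depend on the σ-algebra of the domain and is inherited from strong measurability
of X. -/
theorem stronglyMeasurable_comap_self [TopologicalSpace E]
    [TopologicalSpace.PseudoMetrizableSpace E] [BorelSpace E] {X : Ω → E} (hX : StronglyMeasurable X) :
    StronglyMeasurable[MeasurableSpace.comap X mE] X :=
  (@stronglyMeasurable_iff_measurable_separable Ω E X (MeasurableSpace.comap X mE) _ _ _ _).2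
    ⟨comap_measurable X, hX.isSeparable_range⟩

end PastSigmaAlgebra

/-! ### Linearization of the random product for bounded i.i.d. factors. -/

section BoundedIID

variable {H : Type*} [NormedAddCommGroup H] [InnerProductSpace ℝ H]

theorem norm_one_le_clm : ‖(1 : H →L[ℝ] H)‖ ≤ 1 := ContinuousLinearMap.norm_id_le

/-- The first order contribution of the factor `T` at time `s` to `⟪y, e^M x⟫`. -/
def linTerm (M : H →L[ℝ] H) (x y : H) (s : ℝ) (T : H →L[ℝ] H) : ℝ :=
  ⟪y, (NormedSpace.exp (s • M) * (T - M) * NormedSpace.exp ((1 - s) • M)) x⟫_ℝ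

theorem continuous_linTerm (M : H →L[ℝ] H) (x y : H) (s : ℝ) : Continuous (linTerm M x y s) := by
  unfold linTerm
  fun_prop

theorem abs_inner_clm_le {T : H →L[ℝ] H} {c : ℝ} (hT : ‖T‖ ≤ c) (x y : H) :
    |⟪y, T x⟫_ℝ| ≤ c * (‖x‖ * ‖y‖) := by
  calc |⟪y, T x⟫_ℝ| ≤ ‖y‖ * (‖T‖ * ‖x‖) :=
        (abs_real_inner_le_norm _ _).trans (by gcongr; exact T.le_opNorm x)
    _ ≤ ‖y‖ * (c * ‖x‖) := by gcongr
    _ = _ := by ring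

theorem abs_linTerm_le [CompleteSpace H] {M T : H →L[ℝ] H} {ρ : ℝ} (hM : ‖M‖ ≤ ρ) (hT : ‖T‖ ≤ ρ)
    (x y : H) {s : ℝ} (hs0 : 0 ≤ s) (hs1 : s ≤ 1) :
    |linTerm M x y s T| ≤ Real.exp ρ * (2 * ρ) * Real.exp ρ * (‖x‖ * ‖y‖) := by
  have hρ : 0 ≤ ρ := (norm_nonneg _).trans hM
  refine abs_inner_clm_le (norm_mul_mul_le ?_ ?_ ?_) x y
  · exact (norm_exp_smul_le norm_one_le_clm hM hs0).trans
      (Real.exp_le_exp.2 (mul_le_of_le_one_left hρ hs1))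
  · exact (norm_sub_le _ _).trans (by linarith)
  · exact (norm_exp_smul_le norm_one_le_clm hM (sub_nonneg.2 hs1)).trans
      (Real.exp_le_exp.2 (mul_le_of_le_one_left hρ (by linarith)))

variable [CompleteSpace H] {Ω : Type*} [MeasurableSpace Ω] {P : Measure Ω}
  {A : Ω → H →L[ℝ] H} {X : ℕ → Ω → H →L[ℝ] H} {ρ : ℝ}

theorem continuous_exp_const_smul (h : ℝ) :
    Continuous fun T : H →L[ℝ] H => NormedSpace.exp (h • T) := by
  let : NormedAlgebra ℚ (H →L[ℝ] H) := NormedAlgebra.restrictScalars ℚ ℝ (H →L[ℝ] H)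
  exact NormedSpace.exp_continuous.comp (continuous_const_smul h)

theorem stronglyMeasurable_expProd (hX : ∀ k, StronglyMeasurable (X k)) (n : ℕ) :
    StronglyMeasurable fun ω => expProd (fun k => X k ω) n := by
  have : StronglyMeasurable (partialProd (fun k ω => NormedSpace.exp ((n : ℝ)⁻¹ • X k ω)) n) :=
    stronglyMeasurable_partialProd (m := fun _ => ‹MeasurableSpace Ω›) monotone_const
      (fun k => (continuous_exp_const_smul (n : ℝ)⁻¹).comp_stronglyMeasurable (hX k)) n
  exact this

variable [IsProbabilityMeasure P]

theorem integral_linTerm_eq_zero (hA : Integrable A P) (x y : H) (s : ℝ) :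
    ∫ ω, linTerm (∫ ω, A ω ∂P) x y s (A ω) ∂P = 0 := by
  set M := ∫ ω, A ω ∂P with hM
  let L : (H →L[ℝ] H) →L[ℝ] ℝ := (innerSL ℝ y) ∘L (NormedSpace.exp (s • M)) ∘L
    (ContinuousLinearMap.apply ℝ H (NormedSpace.exp ((1 - s) • M) x))
  have hL : ∀ ω, linTerm M x y s (A ω) = L (A ω - M) := fun ω => rfl
  simp_rw [hL]
  have hi : Integrable (fun ω => A ω - M) P := hA.sub (integrable_const M)
  rw [ContinuousLinearMap.integral_comp_comm L hi, integral_sub hA (integrable_const M), ← hM]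
  simp

/-- The martingale part of `⟪y, e^{X 0 / n} ⋯ e^{X (n - 1) / n} x⟫` of order at least two. -/
theorem integral_inner_quadratic_part_sq_le (hX : ∀ k, StronglyMeasurable (X k))
    (hindep : iIndepFun X P) (hident : ∀ k, IdentDistrib (X k) A P P) {n : ℕ} {b : H →L[ℝ] H}
    (hb : b = ∫ ω, NormedSpace.exp ((n : ℝ)⁻¹ • A ω) ∂P) {β δ : ℝ} (hβ : 1 ≤ β)
    (hbβ : ‖b‖ ≤ β) (hBβ : ∀ k ω, ‖NormedSpace.exp ((n : ℝ)⁻¹ • X k ω)‖ ≤ β)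
    (hδ : ∀ k ω, ‖NormedSpace.exp ((n : ℝ)⁻¹ • X k ω) - b‖ ≤ δ) (x y : H) :
    ∫ ω, ⟪y, (expProd (fun k => X k ω) n - b ^ n - ∑ k ∈ Finset.range n,
      b ^ k * (NormedSpace.exp ((n : ℝ)⁻¹ • X k ω) - b) * b ^ (n - 1 - k)) x⟫_ℝ ^ 2 ∂P ≤
      n * (n * δ ^ 2 * (β ^ n) ^ 2 * ‖y‖ ^ 2 * (δ * (β ^ n * ‖x‖)) ^ 2) := by
  set B : ℕ → Ω → H →L[ℝ] H := fun k ω => NormedSpace.exp ((n : ℝ)⁻¹ • X k ω) with hB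
  have hXm : ∀ k, Measurable (X k) := fun k => (hX k).measurable
  have hexp := continuous_exp_const_smul (H := H) (n : ℝ)⁻¹
  have hBc : ∀ k, StronglyMeasurable[MeasurableSpace.comap (X k) inferInstance] (B k) := fun k =>
    hexp.comp_stronglyMeasurable (stronglyMeasurable_comap_self (hX k))
  have hBm : ∀ k, StronglyMeasurable[past X (k + 1)] (B k) := fun k =>
    (hBc k).mono (comap_le_past_succ X k)
  have hBi : ∀ k, Integrable (B k) P := fun k =>
    Integrable.of_bound (hexp.comp_stronglyMeasurable (hX k)).aestronglyMeasurable β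
      (ae_of_all _ (hBβ k))
  have hBint : ∀ k, ∫ ω, B k ω ∂P = b := fun k => by
    rw [hb]
    exact ((hident k).comp hexp.measurable).integral_eq
  -- The factor B_k is independent of the past, so the conditional expectation is the mean, and b
  -- was chosen to make it zero.
  have hcond : ∀ k, P[fun ω => B k ω - b | past X k] =ᵐ[P] 0 := fun k => by
    have h0 : ∫ ω, (B k ω - b) ∂P = 0 := by
      rw [integral_sub (hBi k) (integrable_const b), hBint k]
      simp
    have := condExp_indep_eq (hXm k).comap_le (past_le hXm k)
      ((hBc k).sub stronglyMeasurable_const) (indep_comap_past hXm hindep k) (f := B k - fun _ => b)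
    refine this.trans (ae_of_all _ fun ω => ?_)
    exact h0
  have hβ0 : 0 ≤ β := zero_le_one.trans hβ
  have hv : ∀ k, ‖(b ^ (n - 1 - k)) x‖ ≤ β ^ n * ‖x‖ := fun k => by
    refine (ContinuousLinearMap.le_opNorm _ _).trans ?_
    gcongr
    refine (norm_pow_le_of_norm_one_le norm_one_le_clm b _).trans
      ((pow_le_pow_left₀ (norm_nonneg _) hbβ _).trans (pow_le_pow_right₀ hβ (by omega)))
  have key := integral_sum_inner_adjointDefect_sq_le (P := P) (monotone_past X) (past_le hXm) hBm
    hcond hβ hBβ hbβ hδ y hv (le_refl n)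
  refine le_of_eq_of_le (integral_congr_ae (ae_of_all _ fun ω => ?_)) key
  have htel := sum_prod_sub_pow_mul (fun k => B k ω) b n
  have hexpProd : expProd (fun k => X k ω) n = ((List.range n).map fun k => B k ω).prod := rfl
  simp only
  rw [hexpProd, ← htel, sum_apply, inner_sum]
  congr 1
  refine Finset.sum_congr rfl fun k _ => ?_
  rw [adjointDefect, ContinuousLinearMap.adjoint_inner_left]
  rfl

/-- The linearization of the random product, with an error of order `1 / n` in `L²`. -/
theorem exists_integral_linearization_error_sq_le (hA : AEStronglyMeasurable A P)
    (hAρ : ∀ᵐ ω ∂P, ‖A ω‖ ≤ ρ)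
    (hX : ∀ k, StronglyMeasurable (X k)) (hXρ : ∀ k ω, ‖X k ω‖ ≤ ρ)
    (hindep : iIndepFun X P) (hident : ∀ k, IdentDistrib (X k) A P P) (x y : H) :
    ∃ C : ℝ, ∀ n : ℕ, 0 < n →
      Integrable (fun ω => (⟪y, (expProd (fun k => X k ω) n - NormedSpace.exp (∫ ω, A ω ∂P)) x⟫_ℝ -
        (n : ℝ)⁻¹ * ∑ k ∈ Finset.range n, linTerm (∫ ω, A ω ∂P) x y ((k : ℝ) / n) (X k ω)) ^ 2) P ∧
      ∫ ω, (⟪y, (expProd (fun k => X k ω) n - NormedSpace.exp (∫ ω, A ω ∂P)) x⟫_ℝ -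
        (n : ℝ)⁻¹ * ∑ k ∈ Finset.range n, linTerm (∫ ω, A ω ∂P) x y ((k : ℝ) / n) (X k ω)) ^ 2 ∂P
        ≤ C * ((n : ℝ)⁻¹) ^ 2 := by
  set M := ∫ ω, A ω ∂P with hM
  have h1 : ‖(1 : H →L[ℝ] H)‖ ≤ 1 := norm_one_le_clm
  have hMρ : ‖M‖ ≤ ρ := norm_integral_le_of_ae_norm_le hAρ
  have hρ : 0 ≤ ρ := (norm_nonneg _).trans hMρ
  have hAi : Integrable A P := Integrable.of_bound hA ρ hAρ
  set E := Real.exp ρ with hE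
  have hE1 : 1 ≤ E := Real.one_le_exp hρ
  have hE0 : 0 ≤ E := zero_le_one.trans hE1
  -- Twice the second order Taylor constant, since b - c and (B_k - b) - h(X_k - M) are each a
  -- difference of two Taylor remainders. `L` bounds the first order size of B_k - b and 1 - c, in
  -- units of h = 1/n.
  set K := 2 * (ρ ^ 2 * E) with hK
  have hK0 : 0 ≤ K := by positivity
  set L := 2 * ρ + K with hL
  have hL0 : 0 ≤ L := by positivity
  set C₁ := L ^ 2 * E ^ 2 * ‖y‖ ^ 2 * (L * (E * ‖x‖)) ^ 2 with hC₁
  set K' := 2 * E ^ 2 * K * L + E ^ 2 * K + E ^ 2 * L ^ 2 with hK'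
  set C₂ := (E * K + K') * (‖x‖ * ‖y‖) with hC₂
  refine ⟨2 * C₁ + 2 * C₂ ^ 2, fun n hn => ?_⟩
  have hn0 : (0 : ℝ) < n := by exact_mod_cast hn
  set h := (n : ℝ)⁻¹ with hh
  have hh0 : 0 < h := inv_pos.2 hn0
  have hh1 : h ≤ 1 := inv_le_one_of_one_le₀ (by exact_mod_cast hn)
  have hnh : n * h = 1 := mul_inv_cancel₀ hn0.ne'
  have hexp := continuous_exp_const_smul (H := H) h
  -- With this β all products of at most n factors are bounded by β^n = e^ρ, uniformly in n.
  set β := Real.exp (h * ρ) with hβdef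
  have hβ : 1 ≤ β := Real.one_le_exp (by positivity)
  have hβn : β ^ n = E := by
    rw [hβdef, ← Real.exp_nat_mul, ← mul_assoc, hnh, one_mul]
  set c := NormedSpace.exp (h • M) with hc
  set b := ∫ ω, NormedSpace.exp (h • A ω) ∂P with hb
  have hcβ : ‖c‖ ≤ β := norm_exp_smul_le h1 hMρ hh0.le
  have hAexp : ∀ᵐ ω ∂P, ‖NormedSpace.exp (h • A ω)‖ ≤ β := by
    filter_upwards [hAρ] with ω hω using norm_exp_smul_le h1 hω hh0.le
  have hbβ : ‖b‖ ≤ β := norm_integral_le_of_ae_norm_le hAexp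
  have hBβ : ∀ k ω, ‖NormedSpace.exp (h • X k ω)‖ ≤ β := fun k ω =>
    norm_exp_smul_le h1 (hXρ k ω) hh0.le
  have hbT : ‖b - 1 - h • M‖ ≤ ρ ^ 2 * E * h ^ 2 := by
    have hbi : Integrable (fun ω => NormedSpace.exp (h • A ω)) P :=
      Integrable.of_bound (hexp.comp_aestronglyMeasurable hA) β hAexp
    have hbi1 : Integrable (fun ω => NormedSpace.exp (h • A ω) - 1) P :=
      hbi.sub (integrable_const 1)
    have hhA : Integrable (fun ω => h • A ω) P := hAi.smul h
    have : b - 1 - h • M = ∫ ω, (NormedSpace.exp (h • A ω) - 1 - h • A ω) ∂P := by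
      rw [integral_sub hbi1 hhA,
        integral_sub hbi (integrable_const 1), integral_smul]
      simp [hb, hM]
    rw [this]
    refine norm_integral_le_of_ae_norm_le ?_
    filter_upwards [hAρ] with ω hω using norm_exp_smul_sub_one_sub_le h1 hω hh0.le hh1
  have hcT : ‖c - 1 - h • M‖ ≤ ρ ^ 2 * E * h ^ 2 :=
    norm_exp_smul_sub_one_sub_le h1 hMρ hh0.le hh1
  have hBT : ∀ k ω, ‖NormedSpace.exp (h • X k ω) - 1 - h • X k ω‖ ≤ ρ ^ 2 * E * h ^ 2 :=
    fun k ω => norm_exp_smul_sub_one_sub_le h1 (hXρ k ω) hh0.le hh1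
  have hbc : ‖b - c‖ ≤ K * h ^ 2 := by
    have : b - c = (b - 1 - h • M) - (c - 1 - h • M) := by abel
    rw [this]
    refine (norm_sub_le _ _).trans ?_
    rw [hK]
    linarith
  have hZD : ∀ k ω, ‖(NormedSpace.exp (h • X k ω) - b) - h • (X k ω - M)‖ ≤ K * h ^ 2 :=
    fun k ω => by
      have : (NormedSpace.exp (h • X k ω) - b) - h • (X k ω - M) =
          (NormedSpace.exp (h • X k ω) - 1 - h • X k ω) - (b - 1 - h • M) := by
        rw [smul_sub]; abel
      rw [this]
      have := hBT k ω
      refine (norm_sub_le _ _).trans ?_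
      rw [hK]
      linarith
  have hD : ∀ k ω, ‖X k ω - M‖ ≤ 2 * ρ := fun k ω =>
    (norm_sub_le _ _).trans (by linarith [hXρ k ω])
  have hDL : ∀ k ω, ‖X k ω - M‖ ≤ L := fun k ω => (hD k ω).trans (by linarith)
  have hh2 : h ^ 2 ≤ h := by
    rw [sq]; exact mul_le_of_le_one_left hh0.le hh1
  have hZ : ∀ k ω, ‖NormedSpace.exp (h • X k ω) - b‖ ≤ L * h := fun k ω => by
    have e : NormedSpace.exp (h • X k ω) - b =
        ((NormedSpace.exp (h • X k ω) - b) - h • (X k ω - M)) + h • (X k ω - M) := by abel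
    have h3 : ‖h • (X k ω - M)‖ ≤ h * (2 * ρ) := by
      rw [norm_smul, Real.norm_of_nonneg hh0.le]
      exact mul_le_mul_of_nonneg_left (hD k ω) hh0.le
    have h4 : K * h ^ 2 ≤ K * h := mul_le_mul_of_nonneg_left hh2 hK0
    rw [e]
    refine (norm_add_le _ _).trans ((add_le_add (hZD k ω) h3).trans ?_)
    rw [hL]
    linarith
  have hc1 : ‖1 - c‖ ≤ L * h := by
    have e : c - 1 = (c - 1 - h • M) + h • M := by abel
    have h3 : ‖h • M‖ ≤ h * ρ := by
      rw [norm_smul, Real.norm_of_nonneg hh0.le]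
      exact mul_le_mul_of_nonneg_left hMρ hh0.le
    have h4 : K * h ^ 2 ≤ K * h := mul_le_mul_of_nonneg_left hh2 hK0
    have h5 : 0 ≤ ρ ^ 2 * E * h ^ 2 := by positivity
    have h6 : 0 ≤ h * ρ := by positivity
    rw [norm_sub_rev, e]
    refine (norm_add_le _ _).trans ((add_le_add hcT h3).trans ?_)
    rw [hL]
    linarith
  set R : Ω → H →L[ℝ] H := fun ω => expProd (fun k => X k ω) n - b ^ n -
    ∑ k ∈ Finset.range n, b ^ k * (NormedSpace.exp (h • X k ω) - b) * b ^ (n - 1 - k) with hR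
  -- The part controlled pointwise: each of the n summands is O(h²) and b^n - c^n is O(h). No
  -- cancellation is used, in contrast to the remainder `R`.
  set S : Ω → H →L[ℝ] H := fun ω => (b ^ n - c ^ n) + ∑ k ∈ Finset.range n,
    (b ^ k * (NormedSpace.exp (h • X k ω) - b) * b ^ (n - 1 - k) -
      h • (c ^ k * (X k ω - M) * c ^ (n - 1 - k + 1))) with hS
  have hquad : ∫ ω, ⟪y, R ω x⟫_ℝ ^ 2 ∂P ≤ C₁ * h ^ 2 := by
    refine (integral_inner_quadratic_part_sq_le hX hindep hident hb hβ hbβ hBβ hZ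
      x y).trans_eq ?_
    rw [hβn, hC₁]
    calc _ = (n * h) ^ 2 * (L ^ 2 * E ^ 2 * ‖y‖ ^ 2 * (L * (E * ‖x‖)) ^ 2) * h ^ 2 := by ring
      _ = _ := by rw [hnh]; ring
  have hSb : ∀ ω, |⟪y, S ω x⟫_ℝ| ≤ C₂ * h := fun ω => by
    have hnorm : ‖S ω‖ ≤ E * K * h + n * (K' * h ^ 2) := by
      refine (norm_add_le _ _).trans (add_le_add ?_ ?_)
      · refine (norm_pow_sub_pow_le h1 hβ hbβ hcβ n).trans ?_
        rw [hβn]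
        calc n * E * ‖b - c‖ ≤ n * E * (K * h ^ 2) := by gcongr
          _ = (n * h) * (E * K * h) := by ring
          _ = E * K * h := by rw [hnh, one_mul]
      · refine (norm_sum_le_of_le _ fun k hk => ?_).trans_eq
          (by rw [Finset.sum_const, Finset.card_range, nsmul_eq_mul])
        have hk := Finset.mem_range.1 hk
        exact norm_pow_mul_mul_pow_sub_le h1 hE1 hβ hβn.le hbβ hcβ hbc (hZD k ω) (hZ k ω)
          (hDL k ω) hc1 (by omega)
    refine (abs_inner_clm_le hnorm x y).trans_eq ?_
    have : n * (K' * h ^ 2) = K' * h * (n * h) := by ring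
    rw [this, hnh, hC₂]
    ring
  have hdecomp : ∀ ω, ⟪y, (expProd (fun k => X k ω) n - NormedSpace.exp M) x⟫_ℝ -
      h * ∑ k ∈ Finset.range n, linTerm M x y ((k : ℝ) / n) (X k ω) =
      ⟪y, R ω x⟫_ℝ + ⟪y, S ω x⟫_ℝ := fun ω => by
    have hcpow : ∀ j : ℕ, c ^ j = NormedSpace.exp (((j : ℝ) / n) • M) := fun j =>
      exp_inv_smul_pow M j
    have hcn : c ^ n = NormedSpace.exp M := by
      rw [hcpow, div_self hn0.ne', one_smul]
    have hlin : h * ∑ k ∈ Finset.range n, linTerm M x y ((k : ℝ) / n) (X k ω) =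
        ⟪y, (∑ k ∈ Finset.range n, h • (c ^ k * (X k ω - M) * c ^ (n - 1 - k + 1))) x⟫_ℝ := by
      rw [sum_apply, inner_sum, Finset.mul_sum]
      refine Finset.sum_congr rfl fun k hk => ?_
      have hk := Finset.mem_range.1 hk
      have e1 : n - 1 - k + 1 = n - k := by omega
      have e2 : ((n - k : ℕ) : ℝ) / n = 1 - (k : ℝ) / n := by
        rw [Nat.cast_sub hk.le, sub_div, div_self hn0.ne']
      rw [smul_apply, real_inner_smul_right, e1, hcpow, hcpow, e2]
      rfl
    rw [hlin, ← inner_sub_right, ← inner_add_right, ← sub_apply,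
      ← add_apply, ← hcn]
    congr 2
    simp only [hR, hS, Finset.sum_sub_distrib]
    abel
  have hexpProdm := stronglyMeasurable_expProd hX n
  have hRm : StronglyMeasurable R :=
    (hexpProdm.sub stronglyMeasurable_const).sub
      (Finset.stronglyMeasurable_fun_sum _ fun k _ =>
        (stronglyMeasurable_const.mul ((hexp.comp_stronglyMeasurable (hX k)).sub
          stronglyMeasurable_const)).mul stronglyMeasurable_const)
  have hRb : ∃ r : ℝ, ∀ ω, ‖R ω‖ ≤ r := by
    refine ⟨E + E + ∑ k ∈ Finset.range n, E * (L * h) * E, fun ω => ?_⟩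
    have hbp : ∀ j ≤ n, ‖b ^ j‖ ≤ E := fun j hj =>
      (norm_pow_le_of_norm_one_le h1 b j).trans ((pow_le_pow_left₀ (norm_nonneg _) hbβ j).trans
        ((pow_le_pow_right₀ hβ hj).trans_eq hβn))
    refine (norm_sub_le _ _).trans (add_le_add ((norm_sub_le _ _).trans (add_le_add ?_
      (hbp n le_rfl))) (norm_sum_le_of_le _ fun k hk => ?_))
    · exact (norm_partialProd_le (B := fun k ω => NormedSpace.exp (h • X k ω)) hβ hBβ n ω).trans_eq
        hβn
    · have hk := Finset.mem_range.1 hk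
      exact norm_mul_mul_le (hbp k hk.le) (hZ k ω) (hbp _ (by omega))
  obtain ⟨r, hr⟩ := hRb
  have hSm : StronglyMeasurable S :=
    stronglyMeasurable_const.add (Finset.stronglyMeasurable_fun_sum _ fun k _ =>
      ((stronglyMeasurable_const.mul ((hexp.comp_stronglyMeasurable (hX k)).sub
        stronglyMeasurable_const)).mul stronglyMeasurable_const).sub
        (((stronglyMeasurable_const.mul ((hX k).sub stronglyMeasurable_const)).mul
          stronglyMeasurable_const).const_smul h))
  have hm : ∀ {T : Ω → H →L[ℝ] H}, StronglyMeasurable T →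
      StronglyMeasurable fun ω => ⟪y, T ω x⟫_ℝ := fun hT =>
    stronglyMeasurable_const.inner (stronglyMeasurable_apply hT stronglyMeasurable_const)
  have hRi : Integrable (fun ω => ⟪y, R ω x⟫_ℝ ^ 2) P := by
    refine Integrable.of_bound (C := (r * (‖x‖ * ‖y‖)) ^ 2) ((hm hRm).pow 2).aestronglyMeasurable
      (ae_of_all _ fun ω => ?_)
    rw [Real.norm_of_nonneg (sq_nonneg _), ← sq_abs]
    exact pow_le_pow_left₀ (abs_nonneg _) (abs_inner_clm_le (hr ω) x y) 2
  have hpt : ∀ ω, (⟪y, R ω x⟫_ℝ + ⟪y, S ω x⟫_ℝ) ^ 2 ≤ 2 * ⟪y, R ω x⟫_ℝ ^ 2 + 2 * (C₂ * h) ^ 2 :=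
    fun ω => by
      have h3 : ⟪y, S ω x⟫_ℝ ^ 2 ≤ (C₂ * h) ^ 2 := by
        rw [← sq_abs]; exact pow_le_pow_left₀ (abs_nonneg _) (hSb ω) 2
      linarith [add_sq_le (a := ⟪y, R ω x⟫_ℝ) (b := ⟪y, S ω x⟫_ℝ)]
  have hdom : Integrable (fun ω => 2 * ⟪y, R ω x⟫_ℝ ^ 2 + 2 * (C₂ * h) ^ 2) P :=
    (hRi.const_mul 2).add (integrable_const _)
  have hint : Integrable (fun ω => (⟪y, R ω x⟫_ℝ + ⟪y, S ω x⟫_ℝ) ^ 2) P :=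
    hdom.mono' (((hm hRm).add (hm hSm)).pow 2).aestronglyMeasurable (ae_of_all _ fun ω => by
      rw [Real.norm_of_nonneg (sq_nonneg _)]
      exact hpt ω)
  simp_rw [hdecomp]
  refine ⟨hint, (integral_mono hint hdom hpt).trans ?_⟩
  rw [integral_add (hRi.const_mul 2) (integrable_const _), integral_const_mul]
  simp only [integral_const, probReal_univ, smul_eq_mul, one_mul]
  linarith

end BoundedIID

/-! ### Passage to the limit. -/

section Limit

variable {H : Type*} [NormedAddCommGroup H] [InnerProductSpace ℝ H]
  {Ω : Type*} [MeasurableSpace Ω] {P : Measure Ω} {A : Ω → H →L[ℝ] H} {X : ℕ → Ω → H →L[ℝ] H}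
  {ρ : ℝ}

theorem inner_vecSq_limitCov_nonneg [CompleteSpace H] (h : Integrable (centeredSq P A) P)
    (x y : H) :
    0 ≤ ⟪vecSq y, limitCov P A (vecSq x)⟫_ℝ := by
  rw [inner_vecSq_limitCov]
  refine intervalIntegral.integral_nonneg zero_le_one fun s _ => ?_
  rw [inner_vecSq_covIntegrand h]
  exact integral_nonneg fun ω => sq_nonneg _

/-- The martingale estimates ask for strong measurability and for bounds at every ω. Cutting a
strongly measurable version to 0 where its norm exceeds ρ provides both and changes only a null set.
-/
theorem exists_stronglyMeasurable_bounded_ae_eq {Y : Ω → H →L[ℝ] H}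
    (hY : AEStronglyMeasurable Y P) (hρ : 0 ≤ ρ) (hYρ : ∀ᵐ ω ∂P, ‖Y ω‖ ≤ ρ) :
    ∃ Y' : Ω → H →L[ℝ] H, StronglyMeasurable Y' ∧ (∀ ω, ‖Y' ω‖ ≤ ρ) ∧ Y =ᵐ[P] Y' := by
  have hmk := hY.stronglyMeasurable_mk
  refine ⟨{ω | ‖hY.mk Y ω‖ ≤ ρ}.indicator (hY.mk Y),
    hmk.indicator (hmk.norm.measurableSet_le stronglyMeasurable_const), fun ω => ?_, ?_⟩
  · by_cases h : ‖hY.mk Y ω‖ ≤ ρ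
    · rwa [Set.indicator_of_mem (by exact h)]
    · rwa [Set.indicator_of_notMem (by exact h), norm_zero]
  · filter_upwards [hY.ae_eq_mk, hYρ] with ω h1 h2
    rw [Set.indicator_of_mem (by rw [Set.mem_ofPred_eq, ← h1]; exact h2), h1]

variable [CompleteSpace H]

variable [IsProbabilityMeasure P]

theorem tendstoInDistribution_sum_linTerm (hA : AEStronglyMeasurable A P)
    (hAρ : ∀ᵐ ω ∂P, ‖A ω‖ ≤ ρ) (hX : ∀ k, StronglyMeasurable (X k))
    (hXρ : ∀ k ω, ‖X k ω‖ ≤ ρ) (hindep : iIndepFun X P)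
    (hident : ∀ k, IdentDistrib (X k) A P P) (x y : H) :
    TendstoInDistribution (fun (n : ℕ) ω => ∑ k ∈ Finset.range n,
      (√(n : ℝ))⁻¹ * linTerm (∫ ω, A ω ∂P) x y ((k : ℝ) / n) (X k ω)) atTop (id : ℝ → ℝ)
      (fun _ => P) (gaussianReal 0 (⟪vecSq y, limitCov P A (vecSq x)⟫_ℝ).toNNReal) := by
  have hAi : Integrable A P := Integrable.of_bound hA ρ hAρ
  set M := ∫ ω, A ω ∂P with hM
  have hMρ : ‖M‖ ≤ ρ := norm_integral_le_of_ae_norm_le hAρ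
  have hcont := fun n k : ℕ => continuous_linTerm M x y ((k : ℝ) / n)
  have hcont' : ∀ n k : ℕ, Continuous fun T => (√(n : ℝ))⁻¹ * linTerm M x y ((k : ℝ) / n) T :=
    fun n k => continuous_const.mul (hcont n k)
  refine tendstoInDistribution_sum_triangular
    (ξ := fun (n k : ℕ) ω => (√(n : ℝ))⁻¹ * linTerm M x y ((k : ℝ) / n) (X k ω))
    (K := Real.exp ρ * (2 * ρ) * Real.exp ρ * (‖x‖ * ‖y‖)) (fun n k => ?_) (fun n => ?_)
    (fun n k hk ω => ?_) (fun n k => ?_) ?_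
  · exact (hcont' n k).measurable.comp_aemeasurable (hX k).measurable.aemeasurable
  · exact hindep.comp (fun k T => (√(n : ℝ))⁻¹ * linTerm M x y ((k : ℝ) / n) T)
      fun k => (hcont' n k).measurable
  · have hn : (0 : ℝ) < n := by exact_mod_cast (by omega : 0 < n)
    rw [abs_mul, abs_of_nonneg (inv_nonneg.2 (Real.sqrt_nonneg _)), mul_comm]
    refine mul_le_mul_of_nonneg_right (abs_linTerm_le hMρ (hXρ k ω) x y (by positivity) ?_)
      (inv_nonneg.2 (Real.sqrt_nonneg _))
    rw [div_le_one hn]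
    exact_mod_cast hk.le
  · have h := ((hident k).comp (hcont n k).measurable).integral_eq
    simp only [Function.comp_def] at h
    rw [integral_const_mul, h, integral_linTerm_eq_zero hAi, mul_zero]
  · have hC := integrable_centeredSq hA ⟨ρ, hAρ⟩
    set g : ℝ → ℝ := fun s => ⟪vecSq y, covIntegrand P A s (vecSq x)⟫_ℝ with hg
    have hgc : Continuous g :=
      continuous_const.inner ((continuous_covIntegrand P A).clm_apply continuous_const)
    have hlim := tendsto_riemannSum hgc
    rw [inner_vecSq_limitCov]
    -- The squared normalization (√n)⁻² = n⁻¹ is the mesh of the partition, and each X_k has the law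
    -- of A, so the sum of variances is exactly the left Riemann sum of g.
    refine hlim.congr fun n => Finset.sum_congr rfl fun k _ => ?_
    have h := ((hident k).comp ((hcont n k).pow 2).measurable).integral_eq
    simp only [Function.comp_def, Pi.pow_apply] at h
    simp only [mul_pow, inv_pow, Real.sq_sqrt (Nat.cast_nonneg n), integral_const_mul]
    rw [h]
    simp only [hg]
    rw [inner_vecSq_covIntegrand hC]
    rfl

theorem tendstoInDistribution_inner_expProd (hA : AEStronglyMeasurable A P)
    (hAρ : ∀ᵐ ω ∂P, ‖A ω‖ ≤ ρ) (hX : ∀ k, StronglyMeasurable (X k))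
    (hXρ : ∀ k ω, ‖X k ω‖ ≤ ρ) (hindep : iIndepFun X P)
    (hident : ∀ k, IdentDistrib (X k) A P P) (x y : H) :
    TendstoInDistribution (fun (n : ℕ) ω => ⟪y, (√(n : ℝ) •
      (expProd (fun k => X k ω) n - NormedSpace.exp (∫ ω, A ω ∂P))) x⟫_ℝ) atTop (id : ℝ → ℝ)
      (fun _ => P) (gaussianReal 0 (⟪vecSq y, limitCov P A (vecSq x)⟫_ℝ).toNNReal) := by
  have hm : ∀ n : ℕ, StronglyMeasurable fun ω => ⟪y, (√(n : ℝ) •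
      (expProd (fun k => X k ω) n - NormedSpace.exp (∫ ω, A ω ∂P))) x⟫_ℝ := fun n => by
    have : StronglyMeasurable fun ω => √(n : ℝ) •
        (expProd (fun k => X k ω) n - NormedSpace.exp (∫ ω, A ω ∂P)) :=
      ((stronglyMeasurable_expProd hX n).sub stronglyMeasurable_const).const_smul (√(n : ℝ))
    exact stronglyMeasurable_const.inner (stronglyMeasurable_apply this stronglyMeasurable_const)
  obtain ⟨C, hC⟩ := exists_integral_linearization_error_sq_le hA hAρ hX hXρ hindep hident x y
  -- Slutsky's theorem: it suffices that the difference from the linearized sum tends to 0 in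
  -- measure.
  refine tendstoInDistribution_of_tendstoInMeasure_sub _ _
    (tendstoInDistribution_sum_linTerm hA hAρ hX hXρ hindep hident x y) ?_
    fun n => (hm n).measurable.aemeasurable
  have heq : ∀ (n : ℕ) ω, ⟪y, (√(n : ℝ) •
        (expProd (fun k => X k ω) n - NormedSpace.exp (∫ ω, A ω ∂P))) x⟫_ℝ -
      ∑ k ∈ Finset.range n, (√(n : ℝ))⁻¹ * linTerm (∫ ω, A ω ∂P) x y ((k : ℝ) / n) (X k ω) =
      √(n : ℝ) * (⟪y, (expProd (fun k => X k ω) n - NormedSpace.exp (∫ ω, A ω ∂P)) x⟫_ℝ -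
        (n : ℝ)⁻¹ * ∑ k ∈ Finset.range n, linTerm (∫ ω, A ω ∂P) x y ((k : ℝ) / n) (X k ω)) := by
    intro n ω
    have hs : √(n : ℝ) * (n : ℝ)⁻¹ = (√(n : ℝ))⁻¹ := by
      rw [← div_eq_mul_inv, Real.sqrt_div_self', one_div]
    rw [smul_apply, real_inner_smul_right, mul_sub, ← mul_assoc, hs, Finset.mul_sum]
  refine tendstoInMeasure_zero_of_integral_sq (fun n => ?_) ?_
  · simp only [Pi.sub_apply, heq, mul_pow]
    rcases n.eq_zero_or_pos with rfl | hn
    · simp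
    · exact (hC n hn).1.const_mul _
  -- The factor √n contributes n to the second moment and turns the bound C/n² into C/n.
  · have hlim : Tendsto (fun n : ℕ => C * (n : ℝ)⁻¹) atTop (𝓝 0) := by
      simpa using (tendsto_inv_atTop_nhds_zero_nat (𝕜 := ℝ)).const_mul C
    refine squeeze_zero' (Eventually.of_forall fun n => integral_nonneg fun ω => sq_nonneg _) ?_
      hlim
    filter_upwards [eventually_gt_atTop 0] with n hn
    have hn0 : (0 : ℝ) < n := by exact_mod_cast hn
    simp only [Pi.sub_apply, heq, mul_pow, integral_const_mul, Real.sq_sqrt hn0.le]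
    calc _ ≤ (n : ℝ) * (C * ((n : ℝ)⁻¹) ^ 2) := by gcongr; exact (hC n hn).2
      _ = C * (n : ℝ)⁻¹ := by field_simp

end Limit

end RandomExp

end

theorem theorem1 {H : Type*} [NormedAddCommGroup H] [InnerProductSpace ℝ H] [CompleteSpace H]
    {Ω : Type*} [MeasurableSpace Ω] (P : Measure Ω) [IsProbabilityMeasure P]
    (A : Ω → H →L[ℝ] H) (X : ℕ → Ω → H →L[ℝ] H)
    (hA : AEStronglyMeasurable A P) (hX : ∀ k, AEStronglyMeasurable (X k) P)
    (hbdd : ∃ ρ : ℝ, ∀ᵐ ω ∂P, ‖A ω‖ ≤ ρ)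
    (hindep : iIndepFun X P) (hident : ∀ k, IdentDistrib (X k) A P P) :
    Integrable A P ∧
    Integrable (RandomExp.centeredSq P A) P ∧
    IntervalIntegrable (RandomExp.covIntegrand P A) volume 0 1 ∧
    RandomExp.TendstoInDistributionWOT P
      (fun n ω => √(n : ℝ) •
        (RandomExp.expProd (fun k => X k ω) n - NormedSpace.exp (∫ ω', A ω' ∂P)))
      (RandomExp.limitCov P A) := by
  have hC := RandomExp.integrable_centeredSq hA hbdd
  refine ⟨RandomExp.integrable_of_norm_le hA hbdd, hC,
    (RandomExp.continuous_covIntegrand P A).intervalIntegrable 0 1,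
    fun x y => ⟨RandomExp.inner_vecSq_limitCov_nonneg hC x y, ?_⟩⟩
  obtain ⟨ρ, hρ⟩ := hbdd
  have hρ0 : 0 ≤ ρ := (norm_nonneg _).trans (RandomExp.norm_integral_le_of_ae_norm_le hρ)
  have hXρ : ∀ k, ∀ᵐ ω ∂P, ‖X k ω‖ ≤ ρ := fun k =>
    (hident k).symm.ae_snd (p := fun T => ‖T‖ ≤ ρ)
      (isClosed_le continuous_norm continuous_const).measurableSet hρ
  -- Independence and the common law survive almost sure modification. Only countably many null sets
  -- are involved, so the products agree almost surely as well.
  choose X' hX'm hX'ρ hXX' using fun k =>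
    RandomExp.exists_stronglyMeasurable_bounded_ae_eq (hX k) hρ0 (hXρ k)
  have hindep' : iIndepFun X' P := hindep.congr hXX'
  have hident' : ∀ k, IdentDistrib (X' k) A P P := fun k =>
    (IdentDistrib.of_ae_eq (hident k).aemeasurable_fst (hXX' k)).symm.trans (hident k)
  refine (RandomExp.tendstoInDistribution_inner_expProd hA hρ hX'm hX'ρ hindep' hident'
    x y).congr (fun n => ?_) EventuallyEq.rfl
  filter_upwards [ae_all_iff.2 hXX'] with ω hω
  simp only [hω]
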